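/- **Setting.** Let $G=(V,E)$ be a finite directed graph (parallel edges and loops allowed) with capacities $\nu_e>0$ and transit times $\tau_e>0$ for $e\in E$. Let $I$ be a finite set of commodities; commodity $i$ has a source $s_i$, a sink $t_i$, edge prices $p_{i,e}\ge 0$, an aggregation function $c_i:\mathbb R\times\mathbb R\to\mathbb R$ (continuous and non-decreasing in each argument), and a network inflow rate $u_i:\mathbb R_{\ge0}\to\mathbb R_{\ge0}$ that is bounded and integrable with bounded support. Let $T:=\sup\{\theta\ge 0: u_i(\theta)>0\text{ for some }i\}$ (and $T=0$ if all $u_i$ vanish). Let $\mathcal W$ be the set of pairs $(i,W)$ where $i\in I$ and $W=(e^W_1,\dots,e^W_{k_W})$ is a finite $s_i$-$t_i$-walk, repetitions of nodes and edges being allowed. Functions on $[0,T]$ are extended by zero. Let $$K=\Big\{h\in L^2([0,T])^{\mathcal W}:\ h_i^W\ge 0,\ \ \textstyle\sum_{W}h_i^W(\theta)=u_i(\theta)\text{ for every } i\in I\text{ and a.e. }\theta\ge0\Big\}.$$ **Network loading.** A flow over time $f$ consists of non-negative $f^{W,+}_{i,j},f^{W,-}_{i,j}\in L^2(\mathbb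 R_{\ge0})$ for all $(i,W)\in\mathcal W$ and $1\le j\le k_W$. Put $f_e^\pm=\sum_{(i,W,j):\,e^W_j=e}f^{W,\pm}_{i,j}$, let capital letters denote the integrals over $[0,\theta]$ of the corresponding rates, and put $q_e(\theta)=F_e^+(\theta)-F_e^-(\theta+\tau_e)$ and $T_e(\theta)=\theta+\tau_e+q_e(\theta)/\nu_e$. The flow over time $f$ is *associated with* $h$ if, for all edges $e$ and all $(i,W)\in\mathcal W$: * $f^{W,+}_{i,1}=h_i^W$ a.e. on $\mathbb R_{\ge0}$ (if $k_W\ge1$); * $f^{W,-}_{i,j}=f^{W,+}_{i,j+1}$ a.e. on $\mathbb R_{\ge 0}$, for $1\le j<k_W$; * $f_e^-(\theta+\tau_e)\le\nu_e$ for a.e. $\theta\ge0$; * $F_e^-(\theta+\tau_e)\le F_e^+(\theta)$ for all $\theta\ge0$; * $F^{W,-}_{i,j}(T_{e^W_j}(\theta))=F^{W,+}_{i,j}(\theta)$ for all $\theta\ge0$ and $1\le j\le k_W$. For a walk $W$ let $\mu_i^W(\theta)=\big(T_{e^W_{k_W}}\circ\dots\circ T_{e^W_1}\big)(\theta)-\theta$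 be the travel time when entering $W$ at time $\theta$. **Statement.** Let $S\subseteq L^2([0,T])^{\mathcal W}$ be any restriction set and $\mathcal W'\subseteq\mathcal W$ any finite set (for instance a closed convex $S$ and a finite dominating set $\mathcal W'$ with respect to $S$). Let $C\subseteq L^2([0,T])^{\mathcal W'}$ be the set of those $h$ whose extension by zero to $\mathcal W$ lies in $S\cap K$. A map $\mathcal A:C\to X$ into a topological space is called *sequentially weak-strong continuous* if $\mathcal A(h^k)\to\mathcal A(h)$ in $X$ whenever $h^k,h\in C$ and $h^k\to h$ weakly in $L^2([0,T])^{\mathcal W'}$. Then: 1. Every $h\in C$ has exactly one associated flow over time (up to null sets). In particular $T_e$ and $\mu_i^W$ are well-defined functions of $h\in C$. 2. For every $M\ge0$ and every edge $e$, the map $C\to C([0,M])$, $h\mapsto T_e|_{[0,M]}$, is well defined and sequentially weak-strong continuous with respect to the uniform norm. 3. For every $(i,W)\in\mathcal W'$, the map $$C\to L^2([0,T]),\qquad h\mapsto\Big(\theta\mapsto c_i\big(\mu_i^W(\theta),\textstyle\sum_{e\in W}p_{i,e}\big)\Big),$$ is well defined and sequentially weak-strong continuous. -/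

import Mathlib

open MeasureTheory Set Filter Topology

noncomputable section

namespace VickreyFlow

/-- The space `L²([0, T])` (classes modulo null sets). -/
abbrev L2On (T : ℝ) : Type := Lp ℝ 2 (volume.restrict (Icc (0 : ℝ) T))

/-- The space `L²(ℝ_{≥0})` (classes modulo null sets). -/
abbrev L2Half : Type := Lp ℝ 2 (volume.restrict (Ici (0 : ℝ)))

/-- A function on `[0, T]`, extended by zero to the whole line. -/
def extendZero {T : ℝ} (g : L2On T) : ℝ → ℝ := (Icc (0 : ℝ) T).indicator g

/-- A finite directed network (parallel edges and loops are allowed) with positive capacities `ν`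
and transit times `τ`, commodities with sources `s`, sinks `t` and network inflow rates `u`
(non-negative, bounded, integrable, with bounded support on `ℝ_{≥0}`; values at negative times are
irrelevant), and edge prices `p`. -/
structure Network (V E I : Type*) where
  src : E → V
  tgt : E → V
  ν : E → ℝ
  τ : E → ℝ
  s : I → V
  t : I → V
  p : I → E → ℝ
  u : I → ℝ → ℝ
  ν_pos : ∀ e, 0 < ν e
  τ_pos : ∀ e, 0 < τ e
  p_nonneg : ∀ i e, 0 ≤ p i e
  u_nonneg : ∀ i θ, 0 ≤ θ → 0 ≤ u i θ
  u_bounded : ∀ i, ∃ B, ∀ θ, 0 ≤ θ → u i θ ≤ B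
  u_integrable : ∀ i, IntegrableOn (u i) (Ici 0)
  u_support : ∀ i, ∃ B, ∀ θ, B < θ → u i θ = 0

/-- An aggregation function: continuous, and non-decreasing in both arguments. -/
structure IsAggregationFunction (c : ℝ → ℝ → ℝ) : Prop where
  continuous : Continuous fun x : ℝ × ℝ => c x.1 x.2
  mono_left : ∀ y, Monotone fun x => c x y
  mono_right : ∀ x, Monotone fun y => c x y

/-- Weak convergence of a sequence in `L²([0, T])^ι`, `ι` finite. -/
def WeakTendsto {ι : Type*} [Fintype ι] {T : ℝ} (h : ℕ → ι → L2On T) (h' : ι → L2On T) : Prop :=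
  ∀ g : ι → L2On T, Tendsto (fun k => ∑ a, (inner ℝ (h k a) (g a) : ℝ)) atTop
    (𝓝 (∑ a, (inner ℝ (h' a) (g a) : ℝ)))

/-- `A` is sequentially weak-strong continuous on `C`. -/
def SeqWeakStrongContinuousOn {ι : Type*} [Fintype ι] {T : ℝ} {X : Type*} [TopologicalSpace X]
    (A : (ι → L2On T) → X) (C : Set (ι → L2On T)) : Prop :=
  ∀ (h : ℕ → ι → L2On T) (h' : ι → L2On T), (∀ k, h k ∈ C) → h' ∈ C → WeakTendsto h h' →
    Tendsto (fun k => A (h k)) atTop (𝓝 (A h'))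

namespace Network

variable {V E I : Type*} (N : Network V E I)

/-- The last time at which a vehicle enters the network. -/
def horizon : ℝ := sSup {θ : ℝ | 0 ≤ θ ∧ ∃ i, 0 < N.u i θ}

/-- `N.IsWalk v w l`: the edge sequence `l` is a walk from `v` to `w`. -/
def IsWalk : V → V → List E → Prop
  | v, w, [] => v = w
  | v, w, e :: l => N.src e = v ∧ IsWalk (N.tgt e) w l

/-- All pairs `(i, W)` of a commodity `i` and an `s_i`-`t_i`-walk `W`. -/
def CWalk : Type _ := {x : I × List E // N.IsWalk (N.s x.1) (N.t x.1) x.2}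

variable {N}

/-- The commodity `i` of a pair `(i, W)`. -/
def CWalk.com (w : N.CWalk) : I := w.1.1

/-- The edge sequence `W` of a pair `(i, W)`. -/
def CWalk.edges (w : N.CWalk) : List E := w.1.2

/-- The total price of the walk (with multiplicities) for its commodity. -/
def CWalk.price (w : N.CWalk) : ℝ := (w.edges.map (N.p w.com)).sum

variable (N)

/-- Triples of a commodity, a walk and a position of an edge in it (counted from zero). -/
abbrev Pos : Type _ := Σ w : N.CWalk, Fin w.edges.length

variable {N}

/-- The edge at a given position. -/
def edgeAt (r : N.Pos) : E := r.1.edges.get r.2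

variable (N)

/-- The space `L²([0, T])^𝒲` of families indexed by all pairs `(i, W)`. -/
abbrev WalkFamily : Type _ := N.CWalk → L2On N.horizon

/-- The set `K` of walk-flows: non-negative families that match the network inflow rates. -/
def walkFlows : Set N.WalkFamily :=
  {h | (∀ w, 0 ≤ h w) ∧
    ∀ i, ∀ᵐ θ ∂(volume.restrict (Ici (0 : ℝ))),
      HasSum (fun w : {w : N.CWalk // w.com = i} => extendZero (h w.1) θ) (N.u i θ)}

/-- A flow over time: non-negative square-integrable in- and outflow rates for every position. -/
@[ext]
structure FlowOverTime where
  inflow : N.Pos → L2Half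
  outflow : N.Pos → L2Half
  inflow_nonneg : ∀ r, 0 ≤ inflow r
  outflow_nonneg : ∀ r, 0 ≤ outflow r

instance : Nonempty N.FlowOverTime :=
  ⟨⟨fun _ => 0, fun _ => 0, fun _ => le_rfl, fun _ => le_rfl⟩⟩

namespace FlowOverTime

variable {N} (f : N.FlowOverTime)

/-- Aggregated edge inflow rate `f_e⁺`. -/
def edgeIn (e : E) (θ : ℝ) : ℝ := ∑' r : {r : N.Pos // edgeAt r = e}, f.inflow r.1 θ

/-- Aggregated edge outflow rate `f_e⁻`. -/
def edgeOut (e : E) (θ : ℝ) : ℝ := ∑' r : {r : N.Pos // edgeAt r = e}, f.outflow r.1 θ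

/-- Cumulative inflow at a position. -/
def cumIn (r : N.Pos) (θ : ℝ) : ℝ := ∫ z in (0 : ℝ)..θ, f.inflow r z

/-- Cumulative outflow at a position. -/
def cumOut (r : N.Pos) (θ : ℝ) : ℝ := ∫ z in (0 : ℝ)..θ, f.outflow r z

/-- Cumulative edge inflow `F_e⁺`. -/
def cumEdgeIn (e : E) (θ : ℝ) : ℝ := ∫ z in (0 : ℝ)..θ, f.edgeIn e z

/-- Cumulative edge outflow `F_e⁻`. -/
def cumEdgeOut (e : E) (θ : ℝ) : ℝ := ∫ z in (0 : ℝ)..θ, f.edgeOut e z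

/-- Queue length `q_e`. -/
def queue (e : E) (θ : ℝ) : ℝ := f.cumEdgeIn e θ - f.cumEdgeOut e (θ + N.τ e)

/-- Exit time `T_e`. -/
def exitTime (e : E) (θ : ℝ) : ℝ := θ + (N.τ e + f.queue e θ / N.ν e)

/-- Arrival time at the end of an edge sequence entered at time `θ`. The label function of the
`j`-th node of a walk is the arrival time for the walk with its first `j` edges removed. -/
def arrival : List E → ℝ → ℝ
  | [], θ => θ
  | e :: l, θ => arrival l (f.exitTime e θ)

/-- Total travel time along a walk entered at time `θ`. -/
def travelTime (w : N.CWalk) (θ : ℝ) : ℝ := f.arrival w.edges θ - θ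

/-- `f` is a feasible flow over time associated with `h`. -/
structure IsAssociated (h : N.WalkFamily) (f : N.FlowOverTime) : Prop where
  source : ∀ (w : N.CWalk) (hw : 0 < w.edges.length),
    f.inflow ⟨w, ⟨0, hw⟩⟩ =ᵐ[volume.restrict (Ici (0 : ℝ))] extendZero (h w)
  node : ∀ (w : N.CWalk) (j : ℕ) (hj : j + 1 < w.edges.length),
    f.outflow ⟨w, ⟨j, Nat.lt_of_succ_lt hj⟩⟩ =ᵐ[volume.restrict (Ici (0 : ℝ))]
      f.inflow ⟨w, ⟨j + 1, hj⟩⟩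
  capacity : ∀ e, ∀ᵐ θ ∂(volume.restrict (Ici (0 : ℝ))), f.edgeOut e (θ + N.τ e) ≤ N.ν e
  weakConservation : ∀ e θ, 0 ≤ θ → f.cumEdgeOut e (θ + N.τ e) ≤ f.cumEdgeIn e θ
  linkTransfer : ∀ (r : N.Pos) (θ : ℝ), 0 ≤ θ →
    f.cumOut r (f.exitTime (edgeAt r) θ) = f.cumIn r θ

end FlowOverTime

variable {N}

/-- The network loading: the feasible flow over time associated with `h` (an arbitrary flow over
time if there is none). -/
def loading (h : N.WalkFamily) : N.FlowOverTime :=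
  Classical.epsilon fun f => FlowOverTime.IsAssociated h f

open Classical in
/-- The canonical embedding of `L²([0, T])^𝒲'` into `L²([0, T])^𝒲` (extension by zero). -/
def embed (W' : Finset N.CWalk) (h : W' → L2On N.horizon) : N.WalkFamily :=
  fun w => if hw : w ∈ W' then h ⟨w, hw⟩ else 0

/-- The set `C` of those `h ∈ L²([0, T])^𝒲'` that are, after embedding, walk-flows in `S`. -/
def feasibleSet (S : Set N.WalkFamily) (W' : Finset N.CWalk) : Set (W' → L2On N.horizon) :=
  {h | embed W' h ∈ S ∩ N.walkFlows}

/-- The set `C` is the projection of `S ∩ K ∩ range (embed W')`. -/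
theorem feasibleSet_eq_image (S : Set N.WalkFamily) (W' : Finset N.CWalk) :
    feasibleSet S W' =
      (fun (g : N.WalkFamily) (w : W') => g w.1) '' (S ∩ N.walkFlows ∩ range (embed W')) := by
  have key : ∀ h : W' → L2On N.horizon, (fun w : W' => embed W' h w.1) = h := by
    intro h
    funext w
    simp [embed]
  ext h
  constructor
  · intro hh
    exact ⟨embed W' h, ⟨hh, h, rfl⟩, key h⟩
  · rintro ⟨_, ⟨hg, g, rfl⟩, rfl⟩
    have hk : (fun w : W' => embed W' g w.1) = g := key g
    show embed W' (fun w : W' => embed W' g w.1) ∈ S ∩ N.walkFlows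
    rw [hk]
    exact hg

end Network

end VickreyFlow

end

open MeasureTheory Set Filter Topology

noncomputable section

namespace VickreyFlow

/-! Everything is done with cumulative flows instead of rates. On a single edge with cumulative
inflow `F` the queue is explicit: the exit time is `τ + F θ / ν + sup_{s ≤ θ} (s - F s / ν)`, the
supremum being attained at a time when the queue is empty. The conditions on an associated flow
force this formula (`eq_edgeExit`), and it is stable: a change of `F` by at most `δ` in the past
moves the exit time by at most `2δ/ν` (`abs_edgeExit_sub_le`). A share `G` of `F` leaves as `G`
composed with an inverse of the exit time. This outflow is `ν`-Lipschitz, and up to time `a + τ` it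
depends only on the inflows up to time `a`.

Hence associated flows correspond to fixed points of a causal operator, `DelayNetwork.step`. Each
application gains a delay `τ₀ > 0`, the least transit time. Only finitely many positions carry flow,
so errors grow by a fixed factor per delay. Iteration gives existence; induction over intervals of
length `τ₀` gives uniqueness and Lipschitz dependence on the cumulative network inflow
(`abs_sub_le_of_step_eq`), in the sup norm on every half-line bounded above. Densities are recovered
by differentiating Lipschitz curves (`IsCurve.exists_density`).

Weak convergence enters once: integration up to a fixed time is a bounded functional, so cumulative
inflows converge pointwise. The rates are bounded by a common constant, so these inflows are
equi-Lipschitz and the convergence is uniform (`eventually_abs_networkInflow_sub_le`). Exit times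
then converge locally uniformly. Arrival times are compositions of exit times, and composition, the
aggregation function and restriction to `L²` are all continuous on `C(ℝ, ℝ)`. -/

/-- Cumulative flows: continuous non-decreasing functions vanishing on `(-∞, 0]`. -/
structure IsCurve (F : ℝ → ℝ) : Prop where
  mono : Monotone F
  cont : Continuous F
  zero : ∀ θ ≤ 0, F θ = 0

lemma IsCurve.nonneg {F : ℝ → ℝ} (hF : IsCurve F) (θ : ℝ) : 0 ≤ F θ := by
  rw [← hF.zero (min θ 0) (min_le_right _ _)]
  exact hF.mono (min_le_left _ _)

lemma isCurve_zero : IsCurve 0 := ⟨fun _ _ _ => le_rfl, continuous_const, fun _ _ => rfl⟩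

lemma isCurve_sum {ι : Type*} {s : Finset ι} {F : ι → ℝ → ℝ} (hF : ∀ i ∈ s, IsCurve (F i)) :
    IsCurve fun θ => ∑ i ∈ s, F i θ where
  mono _ _ h := Finset.sum_le_sum fun i hi => (hF i hi).mono h
  cont := continuous_finsetSum _ fun i hi => (hF i hi).cont
  zero θ h := Finset.sum_eq_zero fun i hi => (hF i hi).zero θ h

/-- The function `θ ↦ sup_{s ≤ θ} (s - F s / ν)`. -/
def runningSup (ν : ℝ) (F : ℝ → ℝ) (θ : ℝ) : ℝ := sSup ((fun s => s - F s / ν) '' Iic θ)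

/-- The exit time from an edge with capacity `ν`, transit time `τ` and cumulative inflow `F`. -/
def edgeExit (ν τ : ℝ) (F : ℝ → ℝ) (θ : ℝ) : ℝ := τ + F θ / ν + runningSup ν F θ

/-- The cumulative outflow of a share `G` of the cumulative inflow `F` into an edge. -/
def edgeOutflow (ν τ : ℝ) (F G : ℝ → ℝ) (t : ℝ) : ℝ := G (Function.invFun (edgeExit ν τ F) t)

/-! ### A single edge: exit time and outflow as functionals of the inflow curve -/

section Edge

variable {ν τ : ℝ} {F F' G G' : ℝ → ℝ}

lemma runningSup_le (θ b : ℝ) (h : ∀ s ≤ θ, s - F s / ν ≤ b) : runningSup ν F θ ≤ b :=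
  csSup_le (nonempty_Iic.image _) (by rintro _ ⟨s, hs, rfl⟩; exact h s hs)

lemma le_runningSup (hν : 0 < ν) (hF : IsCurve F) {s θ : ℝ} (h : s ≤ θ) :
    s - F s / ν ≤ runningSup ν F θ := by
  refine le_csSup ⟨θ, ?_⟩ ⟨s, h, rfl⟩
  rintro _ ⟨z, hz, rfl⟩
  have := div_nonneg (hF.nonneg z) hν.le
  have hz' : z ≤ θ := hz
  show z - F z / ν ≤ θ
  linarith

lemma runningSup_mono (hν : 0 < ν) (hF : IsCurve F) : Monotone (runningSup ν F) :=
  fun _ _ h => runningSup_le _ _ fun _ hs => le_runningSup hν hF (hs.trans h)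

lemma runningSup_le_add (hν : 0 < ν) (hF : IsCurve F) {a b : ℝ} (h : a ≤ b) :
    runningSup ν F b ≤ runningSup ν F a + (b - a) := by
  refine runningSup_le _ _ fun s hs => ?_
  rcases le_total s a with h' | h'
  · have := le_runningSup hν hF h'
    linarith
  · have := le_runningSup hν hF (le_refl a)
    have := div_le_div_of_nonneg_right (hF.mono h') hν.le
    linarith

lemma continuous_runningSup (hν : 0 < ν) (hF : IsCurve F) : Continuous (runningSup ν F) := by
  refine (LipschitzWith.of_le_add fun x y => ?_).continuous
  rcases le_total x y with h | h
  · have := runningSup_mono hν hF h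
    have := dist_nonneg (x := x) (y := y)
    linarith
  · have := runningSup_le_add hν hF h
    rw [Real.dist_eq, abs_of_nonneg (by linarith)]
    linarith

lemma continuous_edgeExit (hν : 0 < ν) (hF : IsCurve F) : Continuous (edgeExit ν τ F) :=
  (continuous_const.add (hF.cont.div_const _)).add (continuous_runningSup hν hF)

lemma le_edgeExit (hν : 0 < ν) (hF : IsCurve F) (θ : ℝ) : θ + τ ≤ edgeExit ν τ F θ := by
  have := le_runningSup hν hF (le_refl θ)
  unfold edgeExit
  linarith

lemma edgeExit_of_nonpos (hν : 0 < ν) (hF : IsCurve F) {θ : ℝ} (h : θ ≤ 0) :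
    edgeExit ν τ F θ = θ + τ := by
  refine le_antisymm ?_ (le_edgeExit hν hF θ)
  have : runningSup ν F θ ≤ θ := runningSup_le _ _ fun s hs => by
    have := div_nonneg (hF.nonneg s) hν.le
    linarith
  rw [edgeExit, hF.zero θ h]
  simp only [zero_div]
  linarith

/-- This is the capacity bound in integrated form. It holds because the running supremum is
non-decreasing, so the exit time grows at least as fast as `F / ν`. -/
lemma sub_le_edgeExit_sub (hν : 0 < ν) (hF : IsCurve F) {a b : ℝ} (h : a ≤ b) :
    F b - F a ≤ ν * (edgeExit ν τ F b - edgeExit ν τ F a) := by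
  have := runningSup_mono hν hF h
  have : ν * ((F b / ν) - F a / ν) ≤ ν * (edgeExit ν τ F b - edgeExit ν τ F a) := by
    refine mul_le_mul_of_nonneg_left ?_ hν.le
    unfold edgeExit
    linarith
  rwa [mul_sub, mul_div_cancel₀ _ hν.ne', mul_div_cancel₀ _ hν.ne'] at this

lemma edgeExit_mono (hν : 0 < ν) (hF : IsCurve F) : Monotone (edgeExit ν τ F) := fun a b h => by
  have h1 := sub_le_edgeExit_sub (τ := τ) hν hF h
  have h2 := hF.mono h
  have : 0 ≤ edgeExit ν τ F b - edgeExit ν τ F a :=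
    nonneg_of_mul_nonneg_right (by linarith) hν
  linarith

lemma edgeExit_surjective (hν : 0 < ν) (hF : IsCurve F) :
    Function.Surjective (edgeExit ν τ F) := by
  refine (continuous_edgeExit hν hF).surjective ?_ ?_
  · exact tendsto_atTop_mono (le_edgeExit hν hF) (tendsto_atTop_add_const_right _ _ tendsto_id)
  · refine Tendsto.congr' ?_ (tendsto_atBot_add_const_right _ τ tendsto_id)
    filter_upwards [eventually_le_atBot 0] with θ h
    exact (edgeExit_of_nonpos hν hF h).symm

lemma edgeExit_invFun (hν : 0 < ν) (hF : IsCurve F) (t : ℝ) :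
    edgeExit ν τ F (Function.invFun (edgeExit ν τ F) t) = t :=
  Function.invFun_eq (edgeExit_surjective hν hF t)

lemma invFun_edgeExit_le (hν : 0 < ν) (hF : IsCurve F) (t : ℝ) :
    Function.invFun (edgeExit ν τ F) t ≤ t - τ := by
  have := le_edgeExit (τ := τ) hν hF (Function.invFun (edgeExit ν τ F) t)
  rw [edgeExit_invFun hν hF] at this
  linarith

/-- One `δ / ν` comes from the term `F θ / ν`, the other from the supremum, which is 1-Lipschitz in
the sup norm. -/
lemma abs_edgeExit_sub_le (hν : 0 < ν) (hF : IsCurve F) (hF' : IsCurve F') {a δ : ℝ}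
    (h : ∀ s ≤ a, |F s - F' s| ≤ δ) {θ : ℝ} (hθ : θ ≤ a) :
    |edgeExit ν τ F θ - edgeExit ν τ F' θ| ≤ 2 * δ / ν := by
  have key : ∀ {F F' : ℝ → ℝ}, IsCurve F → IsCurve F' → (∀ s ≤ a, |F s - F' s| ≤ δ) →
      edgeExit ν τ F θ - edgeExit ν τ F' θ ≤ 2 * δ / ν := by
    intro F F' hF hF' h
    have hd : ∀ s ≤ a, F s / ν - F' s / ν ≤ δ / ν ∧ F' s / ν - F s / ν ≤ δ / ν := fun s hs => by
      have := abs_le.1 (h s hs)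
      rw [← sub_div, ← sub_div]
      constructor <;> refine div_le_div_of_nonneg_right ?_ hν.le <;> linarith
    have : runningSup ν F θ ≤ runningSup ν F' θ + δ / ν := runningSup_le _ _ fun s hs => by
      have := (hd s (hs.trans hθ)).2
      have := le_runningSup hν hF' hs
      linarith
    have := (hd θ hθ).1
    rw [two_mul, add_div]
    unfold edgeExit
    linarith
  rw [abs_le]
  have h1 := key hF hF' h
  have h2 := key hF' hF fun s hs => by rw [abs_sub_comm]; exact h s hs
  constructor <;> linarith

/-- `G` is the cumulative flow of a part of the particles counted by `F`. -/
def IsShare (G F : ℝ → ℝ) : Prop := ∀ ⦃a b⦄, a ≤ b → G b - G a ≤ F b - F a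

/-- Where the exit time is constant, `F` is constant by the capacity bound, and so is its share `G`.
The choice of inverse made by `Function.invFun` is therefore immaterial. -/
lemma edgeOutflow_edgeExit (hν : 0 < ν) (hF : IsCurve F) (hG : IsCurve G) (h : IsShare G F)
    (θ : ℝ) : edgeOutflow ν τ F G (edgeExit ν τ F θ) = G θ := by
  have key : ∀ a b, a ≤ b → edgeExit ν τ F a = edgeExit ν τ F b → G a = G b := by
    intro a b hab he
    have h1 := sub_le_edgeExit_sub (τ := τ) hν hF hab
    rw [he, sub_self, mul_zero] at h1
    have := hG.mono hab
    have := h hab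
    linarith
  have he := edgeExit_invFun (τ := τ) hν hF (edgeExit ν τ F θ)
  rcases le_total (Function.invFun (edgeExit ν τ F) (edgeExit ν τ F θ)) θ with h' | h'
  · exact key _ _ h' he
  · exact (key _ _ h' he.symm).symm

lemma invFun_edgeExit_mono (hν : 0 < ν) (hF : IsCurve F) :
    Monotone (Function.invFun (edgeExit ν τ F)) := fun a b hab => by
  by_contra! hlt
  have := edgeExit_mono (τ := τ) hν hF hlt.le
  rw [edgeExit_invFun hν hF, edgeExit_invFun hν hF] at this
  obtain rfl := le_antisymm hab this
  exact lt_irrefl _ hlt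

lemma edgeOutflow_sub_le (hν : 0 < ν) (hF : IsCurve F) (h : IsShare G F)
    {a b : ℝ} (hab : a ≤ b) :
    edgeOutflow ν τ F G b - edgeOutflow ν τ F G a ≤ ν * (b - a) := by
  have hm := invFun_edgeExit_mono (τ := τ) hν hF hab
  have := sub_le_edgeExit_sub (τ := τ) hν hF hm
  rw [edgeExit_invFun hν hF, edgeExit_invFun hν hF] at this
  exact (h hm).trans this

lemma edgeOutflow_mono (hν : 0 < ν) (hF : IsCurve F) (hG : IsCurve G) :
    Monotone (edgeOutflow ν τ F G) :=
  hG.mono.comp (invFun_edgeExit_mono hν hF)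

lemma abs_edgeOutflow_sub_le (hν : 0 < ν) (hF : IsCurve F) (hG : IsCurve G) (h : IsShare G F)
    (a b : ℝ) : |edgeOutflow ν τ F G a - edgeOutflow ν τ F G b| ≤ ν * |a - b| := by
  wlog hab : b ≤ a generalizing a b
  · rw [abs_sub_comm, abs_sub_comm a]
    exact this b a (le_of_not_ge hab)
  rw [abs_of_nonneg (sub_nonneg.2 hab),
    abs_of_nonneg (sub_nonneg.2 (edgeOutflow_mono hν hF hG hab))]
  exact edgeOutflow_sub_le hν hF h hab

lemma edgeOutflow_of_le (hν : 0 < ν) (hF : IsCurve F) (hG : IsCurve G) {t : ℝ} (ht : t ≤ τ) :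
    edgeOutflow ν τ F G t = 0 :=
  hG.zero _ (by have := invFun_edgeExit_le (τ := τ) hν hF t; linarith)

lemma isCurve_edgeOutflow (hν : 0 < ν) (hτ : 0 < τ) (hF : IsCurve F) (hG : IsCurve G)
    (h : IsShare G F) : IsCurve (edgeOutflow ν τ F G) where
  mono := edgeOutflow_mono hν hF hG
  cont := (LipschitzWith.of_dist_le_mul (K := ⟨ν, hν.le⟩)
    fun a b => abs_edgeOutflow_sub_le hν hF hG h a b).continuous
  zero _ ht := edgeOutflow_of_le hν hF hG (ht.trans hτ.le)

/-- Both outflows are compared through the particle that leaves the first edge at time `t`. Its two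
exit times differ by at most `2δ/ν`, which the `ν`-Lipschitz outflow turns into `2δ`; the shares
contribute `ε`. It entered by time `a`, so only data up to `a` matter. -/
lemma abs_edgeOutflow_sub_edgeOutflow_le (hν : 0 < ν) (hF : IsCurve F) (hF' : IsCurve F')
    (hG' : IsCurve G') (h' : IsShare G' F') {a δ ε : ℝ}
    (hd : ∀ s ≤ a, |F s - F' s| ≤ δ) (hd' : ∀ s ≤ a, |G s - G' s| ≤ ε) {t : ℝ}
    (ht : t ≤ a + τ) : |edgeOutflow ν τ F G t - edgeOutflow ν τ F' G' t| ≤ 2 * δ + ε := by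
  set y := Function.invFun (edgeExit ν τ F) t with hy
  have hyt : edgeExit ν τ F y = t := edgeExit_invFun hν hF t
  have hya : y ≤ a := by have := invFun_edgeExit_le (τ := τ) hν hF t; linarith
  have h1 : edgeOutflow ν τ F G t = G y := rfl
  have h2 := edgeOutflow_edgeExit (τ := τ) hν hF' hG' h' y
  have h3 := abs_edgeOutflow_sub_le (τ := τ) hν hF' hG' h' (edgeExit ν τ F' y) t
  have h4 := abs_edgeExit_sub_le (τ := τ) hν hF hF' hd hya
  rw [hyt, abs_sub_comm, le_div_iff₀ hν, mul_comm] at h4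
  rw [h2] at h3
  rw [h1]
  have := abs_sub_le (G y) (G' y) (edgeOutflow ν τ F' G' t)
  have := hd' y hya
  linarith

lemma edgeOutflow_le (hν : 0 < ν) (hF : IsCurve F) (hG : IsCurve G) (θ : ℝ) :
    edgeOutflow ν τ F G (θ + τ) ≤ G θ :=
  hG.mono (by have := invFun_edgeExit_le (τ := τ) hν hF (θ + τ); linarith)

/-- The exit time computed from the queue length. -/
lemma edgeExit_eq_queue (hν : 0 < ν) (hF : IsCurve F) (θ : ℝ) :
    edgeExit ν τ F θ = θ + (τ + (F θ - edgeOutflow ν τ F F (θ + τ)) / ν) := by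
  set y := Function.invFun (edgeExit ν τ F) (θ + τ) with hy
  have hyt : edgeExit ν τ F y = θ + τ := edgeExit_invFun hν hF _
  have hyθ : y ≤ θ := by have := invFun_edgeExit_le (τ := τ) hν hF (θ + τ); linarith
  have h1 : edgeOutflow ν τ F F (θ + τ) = F y := rfl
  -- The particle entering at `y` leaves at `θ + τ`, so `runningSup ν F y = θ - F y / ν`. This
  -- already bounds `s - F s / ν` for every `s` in `[y, θ]`.
  have h2 : runningSup ν F θ = runningSup ν F y := by
    refine le_antisymm (runningSup_le _ _ fun s hs => ?_) (runningSup_mono hν hF hyθ)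
    rcases le_total s y with h | h
    · exact le_runningSup hν hF h
    · have := div_le_div_of_nonneg_right (hF.mono h) hν.le
      unfold edgeExit at hyt
      linarith
  rw [h1, sub_div]
  unfold edgeExit at hyt ⊢
  linarith

/-- The exit time is determined by the conditions on the cumulative outflow `D`. -/
lemma eq_edgeExit (hν : 0 < ν) (hF : IsCurve F) {D T : ℝ → ℝ} (hD : Continuous D)
    (hD0 : ∀ t ≤ τ, D t = 0) (hlip : ∀ ⦃a b⦄, a ≤ b → D b - D a ≤ ν * (b - a))
    (hcons : ∀ θ, D (θ + τ) ≤ F θ) (hT : ∀ θ, T θ = θ + (τ + (F θ - D (θ + τ)) / ν))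
    (hlink : ∀ θ, D (T θ) = F θ) : T = edgeExit ν τ F := by
  funext θ
  -- Since `T z = τ + F z / ν + Y z`, the claim is that `Y` is the running supremum. The capacity
  -- bound makes `Y` monotone, and the link condition gives `Y (T z - τ) = Y z`.
  set Y : ℝ → ℝ := fun z => z - D (z + τ) / ν with hY
  have hYc : Continuous Y := by fun_prop
  have hYm : Monotone Y := fun a b hab => by
    have := div_le_div_of_nonneg_right (hlip (add_le_add_left hab τ)) hν.le
    rw [mul_div_cancel_left₀ _ hν.ne', sub_div] at this
    simp only [hY]
    linarith
  have hYT : ∀ z, Y (T z - τ) = Y z := fun z => by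
    simp only [hY, sub_add_cancel, hlink]
    rw [hT z, sub_div]
    ring
  have hY0 : ∀ z ≤ 0, Y z = z := fun z hz => by simp [hY, hD0 (z + τ) (by linarith)]
  have hXY : ∀ z, z - F z / ν ≤ Y z := fun z => by
    have := div_le_div_of_nonneg_right (hcons z) hν.le
    simp only [hY]
    linarith
  suffices hs : runningSup ν F θ = Y θ by
    rw [edgeExit, hs, hT, sub_div]
    simp only [hY]
    ring
  refine le_antisymm (runningSup_le _ _ fun s hs => (hXY s).trans (hYm hs)) ?_
  -- The infimum of `A` is the candidate for the maximiser in the running supremum: the first time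
  -- at which `Y` reaches its value at `θ`.
  set A : Set ℝ := {z | Y θ ≤ Y z} with hA
  have hne : A.Nonempty := ⟨θ, le_refl (Y θ)⟩
  have hbdd : BddBelow A := ⟨min (Y θ) 0, fun z hz => by
    by_contra! hlt
    have h1 := hY0 z (hlt.le.trans (min_le_right _ _))
    have h2 : Y θ ≤ Y z := hz
    have := min_le_left (Y θ) 0
    linarith⟩
  have hcl : IsClosed A := isClosed_le continuous_const hYc
  have hmem : Y θ ≤ Y (sInf A) := hcl.csInf_mem hne hbdd
  have hle : sInf A ≤ θ := csInf_le hbdd (le_refl (Y θ))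
  set s := sInf A
  -- The queue is empty at `s`. Otherwise `T z - τ > s` for some `z < s`, hence `Y z = Y (T z - τ) ≥
  -- Y s`, contradicting the minimality of `s`.
  have hq : F s ≤ D (s + τ) := by
    by_contra! hlt
    have hTc : Continuous T := by
      have : T = fun θ => θ + (τ + (F θ - D (θ + τ)) / ν) := funext hT
      rw [this]
      have := hF.cont
      fun_prop
    have h1 : s < T s - τ := by
      rw [hT s]
      have := div_pos (sub_pos.2 hlt) hν
      linarith
    have h2 : ∀ᶠ z in 𝓝[<] s, s < T z - τ :=
      ((hTc.sub continuous_const).continuousAt.eventually (lt_mem_nhds h1)).filter_mono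
        nhdsWithin_le_nhds
    obtain ⟨z, hz, hzs⟩ := (h2.and self_mem_nhdsWithin).exists
    have h3 : Y s ≤ Y z := (hYm hz.le).trans_eq (hYT z)
    exact absurd (csInf_le hbdd (show z ∈ A from hmem.trans h3)) (not_le.2 hzs)
  have h4 : Y s ≤ s - F s / ν := by
    have := div_le_div_of_nonneg_right hq hν.le
    simp only [hY]
    linarith
  exact hmem.trans (h4.trans (le_runningSup hν hF hle))

end Edge

/-! ### The loading as a fixed point of a causal operator -/

/-- The combinatorial data of a network loading: positions `ρ`, of which finitely many carry flow,
with their edges and the positions that precede them, and the parameters of the edges. -/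
structure DelayNetwork (ρ E : Type*) where
  P : Finset ρ
  edge : ρ → E
  pred : ρ → Option ρ
  ν : E → ℝ
  τ : E → ℝ
  τ₀ : ℝ
  ν_pos : ∀ e, 0 < ν e
  τ₀_pos : 0 < τ₀
  τ₀_le : ∀ e, τ₀ ≤ τ e
  pred_notMem : ∀ r r', pred r = some r' → r ∉ P → r' ∉ P

namespace DelayNetwork

variable {ρ E : Type*} (D : DelayNetwork ρ E) {F F' H H' : ρ → ℝ → ℝ}

/-- Families of cumulative flows that vanish outside `P`. -/
structure IsFamily (F : ρ → ℝ → ℝ) : Prop where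
  curve : ∀ r, IsCurve (F r)
  zero : ∀ r ∉ D.P, F r = 0

open Classical in
/-- Cumulative inflow into an edge. -/
def edgeCurve (F : ρ → ℝ → ℝ) (e : E) (θ : ℝ) : ℝ := ∑ r ∈ D.P with D.edge r = e, F r θ

/-- Exit times from the edges. -/
def exit (F : ρ → ℝ → ℝ) (e : E) : ℝ → ℝ := edgeExit (D.ν e) (D.τ e) (D.edgeCurve F e)

/-- Cumulative outflow at a position. -/
def out (F : ρ → ℝ → ℝ) (r : ρ) : ℝ → ℝ :=
  edgeOutflow (D.ν (D.edge r)) (D.τ (D.edge r)) (D.edgeCurve F (D.edge r)) (F r)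

/-- Cumulative inflow obtained by node balance from the network inflow `H` and the outflow
belonging to `F`. -/
def step (H F : ρ → ℝ → ℝ) (r : ρ) : ℝ → ℝ :=
  match D.pred r with
  | none => H r
  | some r' => D.out F r'

variable {D}

lemma τ_pos (e : E) : 0 < D.τ e := D.τ₀_pos.trans_le (D.τ₀_le e)

lemma step_of_none {r : ρ} (h : D.pred r = none) : D.step H F r = H r := by
  simp [step, h]

lemma step_of_some {r r' : ρ} (h : D.pred r = some r') : D.step H F r = D.out F r' := by
  simp [step, h]

lemma IsFamily.isCurve_edgeCurve (hF : D.IsFamily F) (e : E) : IsCurve (D.edgeCurve F e) :=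
  isCurve_sum fun r _ => hF.curve r

lemma IsFamily.isShare (hF : D.IsFamily F) (r : ρ) :
    IsShare (F r) (D.edgeCurve F (D.edge r)) := by
  classical
  intro a b hab
  by_cases hr : r ∈ D.P
  · rw [edgeCurve, edgeCurve, ← Finset.sum_sub_distrib]
    exact Finset.single_le_sum (f := fun r => F r b - F r a)
      (fun r _ => sub_nonneg.2 ((hF.curve r).mono hab)) (Finset.mem_filter.2 ⟨hr, rfl⟩)
  · rw [hF.zero r hr]
    simpa using (hF.isCurve_edgeCurve _).mono hab

lemma IsFamily.isCurve_out (hF : D.IsFamily F) (r : ρ) : IsCurve (D.out F r) :=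
  isCurve_edgeOutflow (D.ν_pos _) (τ_pos _) (hF.isCurve_edgeCurve _) (hF.curve r) (hF.isShare r)

lemma IsFamily.out_eq_zero (hF : D.IsFamily F) {r : ρ} (hr : r ∉ D.P) : D.out F r = 0 := by
  funext t
  rw [out, edgeOutflow, hF.zero r hr]
  rfl

lemma IsFamily.out_exit (hF : D.IsFamily F) (r : ρ) (θ : ℝ) :
    D.out F r (D.exit F (D.edge r) θ) = F r θ :=
  edgeOutflow_edgeExit (D.ν_pos _) (hF.isCurve_edgeCurve _) (hF.curve r) (hF.isShare r) θ

lemma sum_out (F : ρ → ℝ → ℝ) (e : E) :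
    D.edgeCurve (D.out F) e = edgeOutflow (D.ν e) (D.τ e) (D.edgeCurve F e) (D.edgeCurve F e) := by
  classical
  funext t
  refine Finset.sum_congr rfl fun r hr => ?_
  obtain rfl := (Finset.mem_filter.1 hr).2
  rfl

lemma IsFamily.isFamily_step (hH : D.IsFamily H) (hF : D.IsFamily F) :
    D.IsFamily (D.step H F) where
  curve r := by
    unfold step
    split
    · exact hH.curve r
    · exact hF.isCurve_out _
  zero r hr := by
    unfold step
    split
    · exact hH.zero r hr
    · rename_i r' h
      exact hF.out_eq_zero (D.pred_notMem r r' h hr)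

lemma abs_edgeCurve_sub_le {θ δ : ℝ} (hδ : 0 ≤ δ) (h : ∀ r, |F r θ - F' r θ| ≤ δ) (e : E) :
    |D.edgeCurve F e θ - D.edgeCurve F' e θ| ≤ D.P.card * δ := by
  classical
  rw [edgeCurve, edgeCurve, ← Finset.sum_sub_distrib]
  refine (Finset.abs_sum_le_sum_abs _ _).trans ((Finset.sum_le_card_nsmul _ _ δ
    fun r _ => h r).trans ?_)
  rw [nsmul_eq_mul]
  exact mul_le_mul_of_nonneg_right (Nat.cast_le.2 (Finset.card_filter_le _ _)) hδ

variable (D) in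
/-- The factor by which errors grow in each time step. -/
def growth : ℝ := 2 * D.P.card + 1

lemma one_le_growth : 1 ≤ D.growth := by
  unfold growth
  have : (0 : ℝ) ≤ D.P.card := Nat.cast_nonneg _
  linarith

/-- The edge inflow collects at most `D.P.card` errors `δ` and enters twice; the curve of the
position itself adds one more `δ`. -/
lemma IsFamily.abs_out_sub_le (hF : D.IsFamily F) (hF' : D.IsFamily F') {a δ : ℝ} (hδ : 0 ≤ δ)
    (h : ∀ r, ∀ θ ≤ a, |F r θ - F' r θ| ≤ δ) (r : ρ) {t : ℝ} (ht : t ≤ a + D.τ₀) :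
    |D.out F r t - D.out F' r t| ≤ D.growth * δ := by
  have := abs_edgeOutflow_sub_edgeOutflow_le (D.ν_pos (D.edge r)) (hF.isCurve_edgeCurve _)
    (hF'.isCurve_edgeCurve _) (hF'.curve r) (hF'.isShare r)
    (fun s hs => abs_edgeCurve_sub_le hδ (fun r => h r s hs) (D.edge r)) (h r)
    (ht.trans (add_le_add_right (D.τ₀_le (D.edge r)) a))
  unfold growth
  unfold out
  linarith

lemma IsFamily.abs_step_sub_le (hF : D.IsFamily F) (hF' : D.IsFamily F') {a δ : ℝ} (hδ : 0 ≤ δ)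
    (h : ∀ r, ∀ θ ≤ a, |F r θ - F' r θ| ≤ δ)
    (hH : ∀ r, ∀ θ ≤ a + D.τ₀, |H r θ - H' r θ| ≤ D.growth * δ) (r : ρ) {t : ℝ}
    (ht : t ≤ a + D.τ₀) : |D.step H F r t - D.step H' F' r t| ≤ D.growth * δ := by
  rcases hp : D.pred r with _ | r'
  · rw [step_of_none hp, step_of_none hp]
    exact hH r t ht
  · rw [step_of_some hp, step_of_some hp]
    exact hF.abs_out_sub_le hF' hδ h _ ht

/-- The loading depends on the network inflow in a Lipschitz continuous way. -/
lemma abs_sub_le_of_step_eq (hF : D.IsFamily F) (hF' : D.IsFamily F') (hs : D.step H F = F)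
    (hs' : D.step H' F' = F') {δ : ℝ} (hδ : 0 ≤ δ) (hH : ∀ r θ, |H r θ - H' r θ| ≤ δ) (n : ℕ) :
    ∀ r, ∀ θ ≤ n * D.τ₀, |F r θ - F' r θ| ≤ D.growth ^ n * δ := by
  induction n with
  | zero =>
    intro r θ hθ
    have hθ' : θ ≤ 0 := by simpa using hθ
    rw [(hF.curve r).zero θ hθ', (hF'.curve r).zero θ hθ']
    simpa using hδ
  | succ n ih =>
    intro r θ hθ
    have hp : (1 : ℝ) ≤ D.growth ^ n := one_le_pow₀ one_le_growth
    have hp' : (1 : ℝ) ≤ D.growth ^ (n + 1) := one_le_pow₀ one_le_growth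
    rw [← hs, ← hs', pow_succ', mul_assoc]
    refine hF.abs_step_sub_le hF' (by positivity) ih (fun r θ _ => (hH r θ).trans ?_) r
      (hθ.trans_eq (by push_cast; ring))
    rw [← mul_assoc, ← pow_succ']
    exact le_mul_of_one_le_left hδ hp'

lemma eq_of_step_eq (hF : D.IsFamily F) (hF' : D.IsFamily F') (hs : D.step H F = F)
    (hs' : D.step H F' = F') : F = F' := by
  funext r θ
  obtain ⟨n, hn⟩ := exists_nat_ge (θ / D.τ₀)
  have := abs_sub_le_of_step_eq hF hF' hs hs' le_rfl (fun r θ => by simp) n r θ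
    ((div_le_iff₀ D.τ₀_pos).1 hn)
  rw [mul_zero, abs_nonpos_iff] at this
  linarith

/-- Causality: this is the error estimate with `δ = 0`. -/
lemma IsFamily.step_congr (hF : D.IsFamily F) (hF' : D.IsFamily F') {a : ℝ}
    (h : ∀ r, ∀ θ ≤ a, F r θ = F' r θ) (r : ρ) {t : ℝ} (ht : t ≤ a + D.τ₀) :
    D.step H F r t = D.step H F' r t := by
  have := hF.abs_step_sub_le (H := H) (H' := H) hF' (δ := 0) (a := a) le_rfl
    (fun r θ hθ => by simp [h r θ hθ]) (fun r θ _ => by simp) r ht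
  rw [mul_zero, abs_nonpos_iff] at this
  linarith

/-- The loading exists. -/
lemma IsFamily.exists_step_eq (hH : D.IsFamily H) : ∃ F, D.IsFamily F ∧ D.step H F = F := by
  -- By causality, iterates from the `n`-th on agree up to time `n * τ₀`, whatever the starting
  -- family.
  set A : ℕ → ρ → ℝ → ℝ := fun n => (D.step H)^[n] 0 with hA
  have hsucc : ∀ n, A (n + 1) = D.step H (A n) := fun n => Function.iterate_succ_apply' _ _ _
  have hfam : ∀ n, D.IsFamily (A n) := by
    intro n
    induction n with
    | zero => exact ⟨fun _ => isCurve_zero, fun _ _ => rfl⟩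
    | succ n ih => rw [hsucc]; exact hH.isFamily_step ih
  have hnext : ∀ n : ℕ, ∀ r, ∀ θ ≤ n * D.τ₀, A n r θ = A (n + 1) r θ := by
    intro n
    induction n with
    | zero =>
      intro r θ hθ
      have hθ' : θ ≤ 0 := by simpa using hθ
      rw [((hfam 0).curve r).zero θ hθ', ((hfam _).curve r).zero θ hθ']
    | succ n ih =>
      intro r θ hθ
      rw [hsucc, hsucc (n + 1)]
      exact (hfam n).step_congr (hfam (n + 1)) ih r (hθ.trans_eq (by push_cast; ring))
  have hstab : ∀ n m : ℕ, n ≤ m → ∀ r, ∀ θ ≤ n * D.τ₀, A n r θ = A m r θ := by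
    intro n m hnm
    induction m, hnm using Nat.le_induction with
    | base => exact fun _ _ _ => rfl
    | succ m hnm ih =>
      intro r θ hθ
      rw [ih r θ hθ]
      exact hnext m r θ (hθ.trans (mul_le_mul_of_nonneg_right (Nat.cast_le.2 hnm) D.τ₀_pos.le))
  set F : ρ → ℝ → ℝ := fun r θ => A ⌈θ / D.τ₀⌉₊ r θ with hFdef
  have hceil : ∀ θ : ℝ, θ ≤ ⌈θ / D.τ₀⌉₊ * D.τ₀ := fun θ =>
    (div_le_iff₀ D.τ₀_pos).1 (Nat.le_ceil _)
  have hFA : ∀ (n : ℕ) (r), ∀ θ ≤ n * D.τ₀, F r θ = A n r θ := fun n r θ hθ =>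
    hstab _ _ (Nat.ceil_le.2 ((div_le_iff₀ D.τ₀_pos).2 hθ)) r θ (hceil θ)
  have hFfam : D.IsFamily F := by
    refine ⟨fun r => ⟨fun a b hab => ?_, ?_, fun θ hθ => ((hfam _).curve r).zero θ hθ⟩,
      fun r hr => ?_⟩
    · rw [hFA _ r a (hab.trans (hceil b))]
      exact ((hfam _).curve r).mono hab
    · rw [continuous_iff_continuousAt]
      intro θ
      refine ((hfam ⌈(θ + 1) / D.τ₀⌉₊).curve r).cont.continuousAt.congr ?_
      filter_upwards [gt_mem_nhds (lt_add_one θ)] with z hz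
      exact (hFA _ r z (hz.le.trans (hceil _))).symm
    · funext θ
      simp only [hFdef, (hfam _).zero r hr]
  refine ⟨F, hFfam, ?_⟩
  funext r θ
  set n := ⌈θ / D.τ₀⌉₊
  have h1 : D.step H F r θ = D.step H (A n) r θ :=
    hFfam.step_congr (hfam n) (fun r θ hθ => hFA n r θ hθ) r
      ((hceil θ).trans (le_add_of_nonneg_right D.τ₀_pos.le))
  rw [h1, ← hsucc, ← hnext n r θ (hceil θ)]

/-- Upper bounds for the network inflow are bounds for the loading. -/
lemma IsFamily.le_of_step_eq (hF : D.IsFamily F) (hs : D.step H F = F) {C : ℝ} (hC : 0 ≤ C)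
    (hH : ∀ r θ, H r θ ≤ C) (r : ρ) (θ : ℝ) : F r θ ≤ C := by
  have key : ∀ n : ℕ, ∀ r, ∀ θ ≤ n * D.τ₀, F r θ ≤ C := by
    intro n
    induction n with
    | zero =>
      intro r θ hθ
      rw [(hF.curve r).zero θ (by simpa using hθ)]
      exact hC
    | succ n ih =>
      intro r θ hθ
      rw [← hs]
      rcases hp : D.pred r with _ | r'
      · rw [step_of_none hp]
        exact hH r θ
      · rw [step_of_some hp]
        -- Outflow at `θ` is inflow at a time earlier by at least `τ₀`, to which the induction
        -- hypothesis applies.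
        refine ih _ _ ((invFun_edgeExit_le (D.ν_pos _) (hF.isCurve_edgeCurve _) _).trans ?_)
        have := D.τ₀_le (D.edge r')
        push_cast at hθ
        linarith
  obtain ⟨n, hn⟩ := exists_nat_ge (θ / D.τ₀)
  exact key n r θ ((div_le_iff₀ D.τ₀_pos).1 hn)

lemma IsFamily.out_sub_le (hF : D.IsFamily F) (r : ρ) {a b : ℝ} (hab : a ≤ b) :
    D.out F r b - D.out F r a ≤ D.ν (D.edge r) * (b - a) :=
  edgeOutflow_sub_le (D.ν_pos _) (hF.isCurve_edgeCurve _) (hF.isShare r) hab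

lemma IsFamily.continuous_exit (hF : D.IsFamily F) (e : E) : Continuous (D.exit F e) :=
  continuous_edgeExit (D.ν_pos e) (hF.isCurve_edgeCurve e)

/-- Uniform convergence of the network inflows implies locally uniform convergence of the exit
times. -/
lemma tendstoUniformlyOn_exit {A : ℕ → ρ → ℝ → ℝ} {B : ℕ → ρ → ℝ → ℝ}
    (hA : ∀ k, D.IsFamily (A k)) (hF : D.IsFamily F) (hs : ∀ k, D.step (B k) (A k) = A k)
    (hs' : D.step H F = F)
    (hB : ∀ δ > 0, ∀ᶠ k in atTop, ∀ r θ, |H r θ - B k r θ| ≤ δ) (e : E) (M : ℝ) :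
    TendstoUniformlyOn (fun k => D.exit (A k) e) (D.exit F e) atTop (Iic M) := by
  rw [Metric.tendstoUniformlyOn_iff]
  intro ε hε
  obtain ⟨n, hn⟩ := exists_nat_ge (M / D.τ₀)
  have hn' := (div_le_iff₀ D.τ₀_pos).1 hn
  have hg : 0 < D.growth ^ n := pow_pos (zero_lt_one.trans_le one_le_growth) n
  -- The overall Lipschitz constant from network inflow to exit time up to `n * τ₀`; an inflow error
  -- `ε / (c + 1)` keeps the exit error below `ε`.
  set c : ℝ := 2 * (D.P.card * D.growth ^ n) / D.ν e with hc
  have hc0 : 0 ≤ c := by have := D.ν_pos e; positivity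
  filter_upwards [hB (ε / (c + 1)) (by positivity)] with k hk θ hθ
  have h1 := abs_sub_le_of_step_eq hF (hA k) hs' (hs k) (by positivity) hk n
  have h2 := abs_edgeExit_sub_le (τ := D.τ e) (D.ν_pos e) (hF.isCurve_edgeCurve e)
    ((hA k).isCurve_edgeCurve e) (a := n * D.τ₀)
    (fun s hs => abs_edgeCurve_sub_le (by positivity) (fun r => h1 r s hs) e)
    (le_trans hθ hn')
  refine lt_of_le_of_lt h2 ?_
  have : 2 * (D.P.card * (D.growth ^ n * (ε / (c + 1)))) / D.ν e = c * (ε / (c + 1)) := by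
    rw [hc]; ring
  rw [this, mul_div_assoc', div_lt_iff₀ (by positivity)]
  nlinarith

end DelayNetwork

/-! ### Passing between rates and cumulative flows -/

section Density

lemma L2Half.intervalIntegrable (f : L2Half) {a b : ℝ} (ha : 0 ≤ a) (hb : 0 ≤ b) :
    IntervalIntegrable f volume a b := by
  rw [intervalIntegrable_iff]
  have hsub : uIoc a b ⊆ Ici (0 : ℝ) := fun x hx => (le_min ha hb).trans hx.1.le
  have h1 : MemLp f 2 (volume.restrict (uIoc a b)) :=
    (Lp.memLp f).mono_measure (Measure.restrict_mono hsub le_rfl)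
  have : IsFiniteMeasure (volume.restrict (uIoc a b)) :=
    ⟨by rw [Measure.restrict_apply_univ, uIoc]; exact measure_Ioc_lt_top⟩
  exact h1.integrable one_le_two

lemma ae_hasDerivAt_primitive {f : ℝ → ℝ} (hf : ∀ b, 0 ≤ b → IntervalIntegrable f volume 0 b) :
    ∀ᵐ x ∂volume.restrict (Ici (0 : ℝ)), HasDerivAt (fun θ => ∫ z in (0 : ℝ)..θ, f z) (f x) x := by
  have h : ∀ᵐ x, ∀ n : ℕ, x ∈ uIcc (0 : ℝ) n → ∀ c ∈ uIcc (0 : ℝ) n,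
      HasDerivAt (fun θ => ∫ z in c..θ, f z) (f x) x :=
    ae_all_iff.2 fun n => (hf n (Nat.cast_nonneg n)).ae_hasDerivAt_integral
  rw [ae_restrict_iff' measurableSet_Ici]
  filter_upwards [h] with x hx hx0
  obtain ⟨n, hn⟩ := exists_nat_ge x
  refine hx n ?_ 0 left_mem_uIcc
  rw [uIcc_of_le (Nat.cast_nonneg n)]
  exact ⟨hx0, hn⟩

/-- Primitives are compared only at non-negative times, so derivatives are taken at points having a
neighbourhood there. -/
lemma ae_pos : ∀ᵐ x ∂volume.restrict (Ici (0 : ℝ)), 0 < x := by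
  rw [← restrict_Ioi_eq_restrict_Ici]
  exact ae_restrict_mem measurableSet_Ioi

/-- Integrable functions with the same primitive agree almost everywhere. -/
lemma ae_eq_of_primitive_eq {f g : ℝ → ℝ} (hf : ∀ b, 0 ≤ b → IntervalIntegrable f volume 0 b)
    (hg : ∀ b, 0 ≤ b → IntervalIntegrable g volume 0 b)
    (h : ∀ θ, 0 ≤ θ → ∫ z in (0 : ℝ)..θ, f z = ∫ z in (0 : ℝ)..θ, g z) :
    f =ᵐ[volume.restrict (Ici (0 : ℝ))] g := by
  filter_upwards [ae_hasDerivAt_primitive hf, ae_hasDerivAt_primitive hg, ae_pos] with x h1 h2 hx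
  refine h1.unique (h2.congr_of_eventuallyEq ?_)
  filter_upwards [lt_mem_nhds hx] with y hy using h y hy.le

/-- Integrable functions with a Lipschitz continuous primitive are bounded. -/
lemma ae_le_of_primitive_sub_le {f : ℝ → ℝ} (hf : ∀ b, 0 ≤ b → IntervalIntegrable f volume 0 b)
    {L : ℝ} (h : ∀ a b, 0 ≤ a → a ≤ b →
      (∫ z in (0 : ℝ)..b, f z) - ∫ z in (0 : ℝ)..a, f z ≤ L * (b - a)) :
    ∀ᵐ x ∂volume.restrict (Ici (0 : ℝ)), f x ≤ L := by
  filter_upwards [ae_hasDerivAt_primitive hf, ae_pos] with x h1 hx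
  refine le_of_tendsto (hasDerivAt_iff_tendsto_slope_left_right.1 h1).2 ?_
  filter_upwards [self_mem_nhdsWithin] with y hy
  have hy' : x < y := hy
  rw [slope_def_field, div_le_iff₀ (sub_pos.2 hy')]
  exact h x y hx.le hy'.le

/-- Bounded Lipschitz continuous cumulative flows have square-integrable densities. -/
lemma IsCurve.exists_density {F : ℝ → ℝ} (hF : IsCurve F) {L C : ℝ} (hL : 0 ≤ L)
    (hlip : ∀ a b, a ≤ b → F b - F a ≤ L * (b - a)) (hC : ∀ θ, F θ ≤ C) :
    ∃ g : L2Half, 0 ≤ g ∧ ∀ θ, 0 ≤ θ → ∫ z in (0 : ℝ)..θ, g z = F θ := by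
  have hLip : LipschitzWith ⟨L, hL⟩ F := LipschitzWith.of_dist_le_mul fun a b => by
    rw [Real.dist_eq, Real.dist_eq]
    show |F a - F b| ≤ L * |a - b|
    rcases le_total a b with hab | hab
    · rw [abs_sub_comm, abs_sub_comm a, abs_of_nonneg (sub_nonneg.2 hab),
        abs_of_nonneg (sub_nonneg.2 (hF.mono hab))]
      exact hlip a b hab
    · rw [abs_of_nonneg (sub_nonneg.2 hab), abs_of_nonneg (sub_nonneg.2 (hF.mono hab))]
      exact hlip b a hab
  have hac : ∀ a b, AbsolutelyContinuousOnInterval F a b := fun a b =>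
    (hLip.lipschitzOnWith (s := uIcc a b)).absolutelyContinuousOnInterval
  have hint : ∀ θ, ∫ z in (0 : ℝ)..θ, deriv F z = F θ := fun θ => by
    rw [(hac 0 θ).integral_deriv_eq_sub, hF.zero 0 le_rfl, sub_zero]
  have hnn : ∀ x, 0 ≤ deriv F x := fun x => hF.mono.deriv_nonneg
  have hle : ∀ x, ‖deriv F x‖ ≤ L := fun x => norm_deriv_le_of_lipschitz hLip
  have hmeas : Measurable (deriv F) := measurable_deriv F
  -- Boundedness of `F` gives integrability of the non-negative derivative on the half-line; the
  -- bound `L` then yields square-integrability through `(F')² ≤ L F'`.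
  have hint1 : IntegrableOn (deriv F) (Ici 0) := by
    rw [integrableOn_Ici_iff_integrableOn_Ioi]
    refine integrableOn_Ioi_of_intervalIntegral_norm_bounded C (b := fun n : ℕ => (n : ℝ))
      (l := atTop) 0 (fun n => ?_) tendsto_natCast_atTop_atTop (Eventually.of_forall fun n => ?_)
    · exact ((intervalIntegrable_iff_integrableOn_Ioc_of_le (Nat.cast_nonneg n)).1
        (hac 0 n).intervalIntegrable_deriv)
    · simp only [Real.norm_of_nonneg (hnn _)]
      rw [hint]
      exact hC n
  have hL2 : MemLp (deriv F) 2 (volume.restrict (Ici (0 : ℝ))) := by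
    rw [memLp_two_iff_integrable_sq hmeas.aestronglyMeasurable]
    refine (hint1.norm.const_mul L).mono' (hmeas.pow_const 2).aestronglyMeasurable
      (Eventually.of_forall fun x => ?_)
    rw [norm_pow, sq]
    exact mul_le_mul_of_nonneg_right (hle x) (norm_nonneg _)
  refine ⟨hL2.toLp _, ?_, fun θ hθ => ?_⟩
  · rw [← Lp.coeFn_nonneg]
    filter_upwards [hL2.coeFn_toLp] with x hx
    rw [hx]
    exact hnn x
  · rw [← hint θ]
    refine intervalIntegral.integral_congr_ae_restrict ?_
    rw [uIoc_of_le hθ]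
    exact ae_restrict_of_ae_restrict_of_subset (fun x hx => hx.1.le) hL2.coeFn_toLp

lemma primitive_congr {f g : ℝ → ℝ} (h : f =ᵐ[volume.restrict (Ici (0 : ℝ))] g) {θ : ℝ}
    (hθ : 0 ≤ θ) : ∫ z in (0 : ℝ)..θ, f z = ∫ z in (0 : ℝ)..θ, g z := by
  refine intervalIntegral.integral_congr_ae_restrict ?_
  rw [uIoc_of_le hθ]
  exact ae_restrict_of_ae_restrict_of_subset (fun x hx => hx.1.le) h

lemma ae_add_right {p : ℝ → Prop} (h : ∀ᵐ x ∂volume.restrict (Ici (0 : ℝ)), p x) {τ : ℝ}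
    (hτ : 0 ≤ τ) : ∀ᵐ x ∂volume.restrict (Ici (0 : ℝ)), p (x + τ) := by
  rw [ae_restrict_iff' measurableSet_Ici] at h ⊢
  filter_upwards [(measurePreserving_add_right volume τ).quasiMeasurePreserving.ae h] with x hx hx0
  exact hx (add_nonneg hx0 hτ)

/-- The primitive of a non-negative square-integrable rate, extended by zero. -/
lemma L2Half.isCurve_primitive {f : L2Half} (hf : 0 ≤ f) :
    IsCurve fun θ => ∫ z in (0 : ℝ)..(max θ 0), f z where
  mono a b hab := by
    have ha : 0 ≤ max a 0 := le_max_right _ _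
    have hab' : max a 0 ≤ max b 0 := max_le_max_right 0 hab
    refine intervalIntegral.integral_mono_interval le_rfl ha hab' ?_
      (f.intervalIntegrable le_rfl (ha.trans hab'))
    exact ae_restrict_of_ae_restrict_of_subset (fun x hx => hx.1.le) ((Lp.coeFn_nonneg f).2 hf)
  cont := by
    have h1 : Continuous fun θ : ℝ => ∫ z in (0 : ℝ)..θ, (Ici (0 : ℝ)).indicator f z := by
      refine intervalIntegral.continuous_primitive (fun a b => ?_) 0
      have h2 : ∀ b : ℝ, IntervalIntegrable ((Ici (0 : ℝ)).indicator f) volume 0 b := fun b => by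
        rcases le_total 0 b with hb | hb
        · refine (f.intervalIntegrable le_rfl hb).congr fun x hx => ?_
          rw [uIoc_of_le hb] at hx
          rw [indicator_of_mem (show x ∈ Ici (0 : ℝ) from hx.1.le)]
        · rw [intervalIntegrable_iff, uIoc_of_ge hb, integrableOn_Ioc_iff_integrableOn_Ioo]
          exact integrableOn_zero.congr_fun
            (fun x hx => (indicator_of_notMem (not_le.2 hx.2) _).symm) measurableSet_Ioo
      exact (h2 a).symm.trans (h2 b)
    refine (h1.comp (continuous_id.max (continuous_const (y := (0 : ℝ))))).congr fun θ => ?_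
    refine primitive_congr ?_ (le_max_right θ 0)
    filter_upwards [ae_restrict_mem measurableSet_Ici] with x hx
    rw [indicator_of_mem hx]
  zero θ hθ := by simp [max_eq_right hθ]

end Density

/-! ### Network inflows: from weak to uniform convergence -/

section Extension

variable {T : ℝ} {g : L2On T}

lemma extendZero_integrable (g : L2On T) : Integrable (extendZero g) :=
  (integrable_indicator_iff measurableSet_Icc).2 ((Lp.memLp g).integrable one_le_two)

lemma extendZero_intervalIntegrable (g : L2On T) (a b : ℝ) :
    IntervalIntegrable (extendZero g) volume a b :=
  (extendZero_integrable g).intervalIntegrable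

/-- The cumulative flow of a rate on `[0, T]`. -/
def cumulative (g : L2On T) (θ : ℝ) : ℝ := ∫ z in (0 : ℝ)..θ, extendZero g z

lemma cumulative_sub (g : L2On T) (a b : ℝ) :
    cumulative g b - cumulative g a = ∫ z in a..b, extendZero g z :=
  intervalIntegral.integral_interval_sub_left (extendZero_intervalIntegrable g _ _)
    (extendZero_intervalIntegrable g _ _)

lemma cumulative_zero : cumulative (0 : L2On T) = 0 := by
  funext θ
  have h : extendZero (0 : L2On T) =ᵐ[volume] 0 := by
    have := (ae_restrict_iff' (measurableSet_Icc (a := (0 : ℝ)) (b := T))).1 (Lp.coeFn_zero ℝ 2 (volume.restrict (Icc (0 : ℝ) T)))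
    filter_upwards [this] with x hx
    by_cases hx' : x ∈ Icc 0 T
    · rw [extendZero, indicator_of_mem hx']
      exact hx hx'
    · simp [extendZero, indicator_of_notMem hx']
  rw [cumulative, intervalIntegral.integral_congr_ae (h.mono fun x hx _ => hx)]
  simp

lemma isCurve_cumulative (hg : 0 ≤ g) : IsCurve (cumulative g) where
  mono a b hab := by
    have h : 0 ≤ᵐ[volume] extendZero g := by
      have := (ae_restrict_iff' (measurableSet_Icc (a := (0 : ℝ)) (b := T))).1
        ((Lp.coeFn_nonneg g).2 hg)
      filter_upwards [this] with x hx
      exact indicator_apply_nonneg hx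
    rw [← sub_nonneg, cumulative_sub]
    exact intervalIntegral.integral_nonneg_of_ae hab h
  cont := intervalIntegral.continuous_primitive (extendZero_intervalIntegrable g) 0
  zero θ hθ := by
    rw [cumulative, intervalIntegral.integral_of_ge hθ, integral_Ioc_eq_integral_Ioo,
      setIntegral_eq_zero_of_forall_eq_zero, neg_zero]
    exact fun x hx => indicator_of_notMem (fun h => not_le.2 hx.2 h.1) _

lemma cumulative_of_ge {θ : ℝ} (hθ : T ≤ θ) : cumulative g θ = cumulative g T := by
  rw [← sub_eq_zero, cumulative_sub, intervalIntegral.integral_of_le hθ,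
    setIntegral_eq_zero_of_forall_eq_zero]
  exact fun x hx => indicator_of_notMem (fun h => not_le.2 hx.1 h.2) _

lemma cumulative_sub_le {B : ℝ} (hB : 0 ≤ B)
    (h : ∀ᵐ x ∂volume.restrict (Ici (0 : ℝ)), extendZero g x ≤ B) {a b : ℝ} (hab : a ≤ b) :
    cumulative g b - cumulative g a ≤ B * (b - a) := by
  have h' : ∀ᵐ x, extendZero g x ≤ B := by
    filter_upwards [(ae_restrict_iff' measurableSet_Ici).1 h] with x hx
    by_cases hx0 : 0 ≤ x
    · exact hx hx0
    · rw [extendZero, indicator_of_notMem fun h => hx0 h.1]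
      exact hB
  rw [cumulative_sub]
  refine (intervalIntegral.integral_mono_ae hab (extendZero_intervalIntegrable g a b)
    intervalIntegrable_const h').trans_eq ?_
  rw [intervalIntegral.integral_const, smul_eq_mul, mul_comm]

lemma cumulative_le {B : ℝ} (hT : 0 ≤ T) (hB : 0 ≤ B) (hg : 0 ≤ g)
    (h : ∀ᵐ x ∂volume.restrict (Ici (0 : ℝ)), extendZero g x ≤ B) (θ : ℝ) :
    cumulative g θ ≤ B * T := by
  have h1 : cumulative g T ≤ B * T := by
    have := cumulative_sub_le hB h hT
    rwa [(isCurve_cumulative hg).zero 0 le_rfl, sub_zero, sub_zero] at this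
  rcases le_total θ T with hθ | hθ
  · exact ((isCurve_cumulative hg).mono hθ).trans h1
  · rwa [cumulative_of_ge hθ]

/-- Evaluation of the cumulative flow is a bounded linear functional. -/
lemma exists_inner_eq_cumulative (T θ : ℝ) (hθ : 0 ≤ θ) :
    ∃ φ : L2On T, ∀ g : L2On T, (inner ℝ g φ : ℝ) = cumulative g θ := by
  have : IsFiniteMeasure (volume.restrict (Icc 0 T)) :=
    ⟨by rw [Measure.restrict_apply_univ]; exact measure_Icc_lt_top⟩
  refine ⟨indicatorConstLp 2 (measurableSet_Ioc (a := (0 : ℝ)) (b := θ)) (measure_ne_top _ _) 1,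
    fun g => ?_⟩
  rw [real_inner_comm, L2.inner_indicatorConstLp_one, cumulative,
    intervalIntegral.integral_of_le hθ, extendZero, setIntegral_indicator measurableSet_Icc,
    Measure.restrict_restrict measurableSet_Ioc]

/-- Equi-Lipschitz cumulative flows converge uniformly as soon as they converge pointwise. -/
lemma tendstoUniformly_of_pointwise {A : ℕ → ℝ → ℝ} {F : ℝ → ℝ} {T B : ℝ} (hT : 0 ≤ T)
    (hB : 0 ≤ B) (hA : ∀ k, IsCurve (A k)) (hF : IsCurve F)
    (hAT : ∀ k, ∀ θ ≥ T, A k θ = A k T) (hFT : ∀ θ ≥ T, F θ = F T)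
    (hAB : ∀ k a b, a ≤ b → A k b - A k a ≤ B * (b - a))
    (hFB : ∀ a b, a ≤ b → F b - F a ≤ B * (b - a))
    (h : ∀ θ, 0 ≤ θ → Tendsto (fun k => A k θ) atTop (𝓝 (F θ))) {δ : ℝ} (hδ : 0 < δ) :
    ∀ᶠ k in atTop, ∀ θ, |F θ - A k θ| ≤ δ := by
  -- Mesh of a grid on `[0, T]`: the error is at most `δ / 2` at grid points and varies by at most
  -- `B * ε ≤ δ / 2` between them. The `+ 1` covers `B = 0`.
  set ε : ℝ := δ / (2 * (B + 1)) with hε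
  have hε0 : 0 < ε := by positivity
  have hBε : B * ε ≤ δ / 2 := by
    rw [hε, mul_div_assoc', div_le_div_iff₀ (by positivity) two_pos]
    nlinarith
  obtain ⟨n, hn⟩ := exists_nat_ge (T / ε)
  have hn' := (div_le_iff₀ hε0).1 hn
  have hev : ∀ᶠ k in atTop, ∀ i ∈ Finset.range (n + 1), |F (i * ε) - A k (i * ε)| ≤ δ / 2 := by
    rw [Filter.eventually_all_finset]
    intro i _
    have := (Metric.tendsto_nhds.1 (h (i * ε) (by positivity))) (δ / 2) (by positivity)
    filter_upwards [this] with k hk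
    rw [Real.dist_eq, abs_sub_comm] at hk
    exact hk.le
  filter_upwards [hev] with k hk
  have key : ∀ θ, 0 ≤ θ → θ ≤ T → |F θ - A k θ| ≤ δ := by
    intro θ h0 hθT
    set i := ⌊θ / ε⌋₊
    have hi1 : i * ε ≤ θ := (le_div_iff₀ hε0).1 (Nat.floor_le (by positivity))
    have hi2 : θ ≤ i * ε + ε := by
      have := (div_lt_iff₀ hε0).1 (Nat.lt_floor_add_one (θ / ε))
      linarith
    have hin : i ∈ Finset.range (n + 1) := by
      rw [Finset.mem_range, Nat.lt_succ_iff]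
      have : (i : ℝ) ≤ n := (Nat.floor_le (by positivity)).trans
        ((div_le_div_of_nonneg_right hθT hε0.le).trans hn)
      exact_mod_cast this
    have h1 := abs_le.1 (hk i hin)
    have h2 := hF.mono hi1
    have h3 := (hA k).mono hi1
    have h4 : B * (θ - i * ε) ≤ B * ε := mul_le_mul_of_nonneg_left (by linarith) hB
    have h5 := hFB _ _ hi1
    have h6 := hAB k _ _ hi1
    rw [abs_le]
    constructor <;> linarith
  intro θ
  rcases le_total θ 0 with h0 | h0
  · rw [hF.zero θ h0, (hA k).zero θ h0]
    simpa using hδ.le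
  · rcases le_total θ T with h1 | h1
    · exact key θ h0 h1
    · rw [hFT θ h1, hAT k θ h1]
      exact key T hT le_rfl

end Extension

/-! ### Translating flows over time into the fixed-point problem -/

namespace Network

variable {V E I : Type*} {N : Network V E I}

instance [Finite E] [Finite I] : Countable N.CWalk :=
  inferInstanceAs (Countable {x : I × List E // N.IsWalk (N.s x.1) (N.t x.1) x.2})

/-- The preceding position on the same walk. -/
def predPos : N.Pos → Option N.Pos
  | ⟨_, ⟨0, _⟩⟩ => none
  | ⟨w, ⟨j + 1, h⟩⟩ => some ⟨w, ⟨j, Nat.lt_of_succ_lt h⟩⟩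

/-- The positions on the walks in `W'`. -/
def positions (W' : Finset N.CWalk) : Finset N.Pos := W'.sigma fun _ => Finset.univ

lemma mem_positions {W' : Finset N.CWalk} {r : N.Pos} : r ∈ positions W' ↔ r.1 ∈ W' := by
  simp [positions]

/-- The loading problem for flows on the walks in `W'`. -/
def delayNetwork (W' : Finset N.CWalk) {τ₀ : ℝ} (h₀ : 0 < τ₀) (hτ : ∀ e, τ₀ ≤ N.τ e) :
    DelayNetwork N.Pos E where
  P := positions W'
  edge := edgeAt
  pred := predPos
  ν := N.ν
  τ := N.τ
  τ₀ := τ₀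
  ν_pos := N.ν_pos
  τ₀_pos := h₀
  τ₀_le := hτ
  pred_notMem := by
    rintro ⟨w, ⟨_ | j, hj⟩⟩ r' h
    · exact absurd h (by simp [predPos])
    · simp only [predPos, Option.some.injEq] at h
      subst h
      rw [mem_positions, mem_positions]
      exact id

/-- Cumulative network inflows. -/
def networkInflow (h : N.WalkFamily) (r : N.Pos) : ℝ → ℝ := cumulative (h r.1)

lemma exists_le_transitTime [Finite E] (N : Network V E I) : ∃ τ₀ > 0, ∀ e, τ₀ ≤ N.τ e := by
  cases isEmpty_or_nonempty E
  · exact ⟨1, one_pos, fun e => isEmptyElim e⟩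
  · obtain ⟨e, he⟩ := Finite.exists_min N.τ
    exact ⟨N.τ e, N.τ_pos e, he⟩

lemma exists_inflow_le [Finite I] (N : Network V E I) :
    ∃ B, 0 ≤ B ∧ ∀ i θ, 0 ≤ θ → N.u i θ ≤ B := by
  have := Fintype.ofFinite I
  choose B hB using N.u_bounded
  refine ⟨∑ i, |B i|, Finset.sum_nonneg fun i _ => abs_nonneg _, fun i θ hθ => ?_⟩
  exact (hB i θ hθ).trans ((le_abs_self _).trans
    (Finset.single_le_sum (f := fun i => |B i|) (fun i _ => abs_nonneg _) (Finset.mem_univ i)))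

lemma horizon_nonneg (N : Network V E I) : 0 ≤ N.horizon :=
  Real.sSup_nonneg fun _ h => h.1

/-- Almost everywhere all terms of the sum over walks are non-negative, so each is at most the total
`u i`. Countability of the set of walks allows a single null set. -/
lemma extendZero_le [Finite E] [Finite I] {h : N.WalkFamily} (hh : h ∈ N.walkFlows) {B : ℝ}
    (hB : ∀ i θ, 0 ≤ θ → N.u i θ ≤ B) (w : N.CWalk) :
    ∀ᵐ x ∂volume.restrict (Ici (0 : ℝ)), extendZero (h w) x ≤ B := by
  have h1 : ∀ᵐ x, ∀ w : N.CWalk, 0 ≤ extendZero (h w) x := by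
    refine ae_all_iff.2 fun w => ?_
    filter_upwards [(ae_restrict_iff' (measurableSet_Icc (a := (0 : ℝ)) (b := N.horizon))).1
      ((Lp.coeFn_nonneg (h w)).2 (hh.1 w))] with x hx
    exact indicator_apply_nonneg hx
  filter_upwards [ae_restrict_of_ae h1, hh.2 w.com, ae_restrict_mem measurableSet_Ici]
    with x hx hs hx0
  exact (le_hasSum hs ⟨w, rfl⟩ fun w' _ => hx w').trans (hB _ _ hx0)

lemma embed_of_notMem {W' : Finset N.CWalk} (h : W' → L2On N.horizon) {w : N.CWalk}
    (hw : w ∉ W') : embed W' h w = 0 := by simp [embed, hw]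

lemma embed_of_mem {W' : Finset N.CWalk} (h : W' → L2On N.horizon) {w : N.CWalk}
    (hw : w ∈ W') : embed W' h w = h ⟨w, hw⟩ := by simp [embed, hw]

section Loading

variable {W' : Finset N.CWalk} {τ₀ : ℝ} {h₀ : 0 < τ₀} {hτ : ∀ e, τ₀ ≤ N.τ e}

lemma isFamily_networkInflow {h : N.WalkFamily} (hh : ∀ w, 0 ≤ h w) (hz : ∀ w ∉ W', h w = 0) :
    (delayNetwork W' h₀ hτ).IsFamily (networkInflow h) where
  curve r := isCurve_cumulative (hh r.1)
  zero r hr := by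
    rw [networkInflow, hz r.1 fun h => hr (mem_positions.2 h), cumulative_zero]

end Loading

namespace FlowOverTime

variable (f : N.FlowOverTime)

/-- Cumulative inflows, extended by zero to negative times. -/
def inflowCurve (r : N.Pos) (θ : ℝ) : ℝ := f.cumIn r (max θ 0)

/-- Cumulative outflows, extended by zero to negative times. -/
def outflowCurve (r : N.Pos) (θ : ℝ) : ℝ := f.cumOut r (max θ 0)

lemma isCurve_inflowCurve (r : N.Pos) : IsCurve (f.inflowCurve r) :=
  L2Half.isCurve_primitive (f.inflow_nonneg r)

lemma isCurve_outflowCurve (r : N.Pos) : IsCurve (f.outflowCurve r) :=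
  L2Half.isCurve_primitive (f.outflow_nonneg r)

variable {f}

lemma inflowCurve_of_nonneg {r : N.Pos} {θ : ℝ} (hθ : 0 ≤ θ) :
    f.inflowCurve r θ = f.cumIn r θ := by
  rw [inflowCurve, max_eq_left hθ]

lemma outflowCurve_of_nonneg {r : N.Pos} {θ : ℝ} (hθ : 0 ≤ θ) :
    f.outflowCurve r θ = f.cumOut r θ := by
  rw [outflowCurve, max_eq_left hθ]

open Classical in
/-- If only finitely many positions carry flow, then edge rates are finite sums. -/
lemma tsum_ae_eq_sum [Finite E] [Finite I] {P : Finset N.Pos} {x : N.Pos → L2Half}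
    (hx : ∀ r ∉ P, x r =ᵐ[volume.restrict (Ici (0 : ℝ))] 0) (e : E) :
    (fun θ => ∑' r : {r : N.Pos // edgeAt r = e}, x r.1 θ) =ᵐ[volume.restrict (Ici (0 : ℝ))]
      fun θ => ∑ r ∈ P with edgeAt r = e, x r θ := by
  have h : ∀ᵐ θ ∂volume.restrict (Ici (0 : ℝ)), ∀ r : N.Pos, r ∉ P → x r θ = 0 :=
    ae_all_iff.2 fun r => by
      by_cases hr : r ∈ P
      · exact Eventually.of_forall fun θ h => absurd hr h
      · filter_upwards [hx r hr] with θ hθ _ using hθ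
  filter_upwards [h] with θ hθ
  rw [tsum_eq_sum (s := P.subtype fun r => edgeAt r = e) fun r hr =>
    hθ r.1 fun h => hr (Finset.mem_subtype.2 h)]
  exact Finset.sum_subtype_eq_sum_filter (fun r => x r θ)

lemma primitive_sum {P : Finset N.Pos} (x : N.Pos → L2Half) {θ : ℝ} (hθ : 0 ≤ θ) :
    ∫ z in (0 : ℝ)..θ, ∑ r ∈ P, x r z = ∑ r ∈ P, ∫ z in (0 : ℝ)..θ, x r z :=
  intervalIntegral.integral_finsetSum fun r _ => (x r).intervalIntegrable le_rfl hθ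

lemma ae_eq_zero_of_inflowCurve {r : N.Pos} (h : f.inflowCurve r = 0) :
    f.inflow r =ᵐ[volume.restrict (Ici (0 : ℝ))] 0 :=
  ae_eq_of_primitive_eq (fun b hb => (f.inflow r).intervalIntegrable le_rfl hb)
    (fun b _ => intervalIntegrable_const) fun θ hθ => by
      have := inflowCurve_of_nonneg (f := f) (r := r) hθ
      rw [h] at this
      rw [show ∫ z in (0 : ℝ)..θ, (0 : ℝ → ℝ) z = 0 from intervalIntegral.integral_zero]
      exact this.symm

lemma ae_eq_zero_of_outflowCurve {r : N.Pos} (h : f.outflowCurve r = 0) :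
    f.outflow r =ᵐ[volume.restrict (Ici (0 : ℝ))] 0 :=
  ae_eq_of_primitive_eq (fun b hb => (f.outflow r).intervalIntegrable le_rfl hb)
    (fun b _ => intervalIntegrable_const) fun θ hθ => by
      have := outflowCurve_of_nonneg (f := f) (r := r) hθ
      rw [h] at this
      rw [show ∫ z in (0 : ℝ)..θ, (0 : ℝ → ℝ) z = 0 from intervalIntegral.integral_zero]
      exact this.symm

section

variable [Finite E] [Finite I] {W' : Finset N.CWalk} {τ₀ : ℝ} {h₀ : 0 < τ₀}
  {hτ : ∀ e, τ₀ ≤ N.τ e}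

lemma edgeIn_ae_eq [DecidableEq E]
    (hf : ∀ r ∉ positions W', f.inflow r =ᵐ[volume.restrict (Ici (0 : ℝ))] 0) (e : E) :
    f.edgeIn e =ᵐ[volume.restrict (Ici (0 : ℝ))]
      fun θ => ∑ r ∈ positions W' with edgeAt r = e, f.inflow r θ := by
  convert tsum_ae_eq_sum hf e
  rfl

lemma edgeOut_ae_eq [DecidableEq E]
    (hf : ∀ r ∉ positions W', f.outflow r =ᵐ[volume.restrict (Ici (0 : ℝ))] 0) (e : E) :
    f.edgeOut e =ᵐ[volume.restrict (Ici (0 : ℝ))]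
      fun θ => ∑ r ∈ positions W' with edgeAt r = e, f.outflow r θ := by
  convert tsum_ae_eq_sum hf e
  rfl

lemma cumEdgeIn_eq
    (hf : ∀ r ∉ positions W', f.inflow r =ᵐ[volume.restrict (Ici (0 : ℝ))] 0) (e : E) {θ : ℝ}
    (hθ : 0 ≤ θ) : f.cumEdgeIn e θ = (delayNetwork W' h₀ hτ).edgeCurve f.inflowCurve e θ := by
  classical
  rw [cumEdgeIn, primitive_congr (edgeIn_ae_eq hf e) hθ, primitive_sum _ hθ, DelayNetwork.edgeCurve]
  exact Finset.sum_congr rfl fun r _ => (inflowCurve_of_nonneg hθ).symm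

lemma cumEdgeOut_eq
    (hf : ∀ r ∉ positions W', f.outflow r =ᵐ[volume.restrict (Ici (0 : ℝ))] 0) (e : E) {θ : ℝ}
    (hθ : 0 ≤ θ) : f.cumEdgeOut e θ = (delayNetwork W' h₀ hτ).edgeCurve f.outflowCurve e θ := by
  classical
  rw [cumEdgeOut, primitive_congr (edgeOut_ae_eq hf e) hθ, primitive_sum _ hθ, DelayNetwork.edgeCurve]
  exact Finset.sum_congr rfl fun r _ => (outflowCurve_of_nonneg hθ).symm

lemma edgeOut_intervalIntegrable
    (hf : ∀ r ∉ positions W', f.outflow r =ᵐ[volume.restrict (Ici (0 : ℝ))] 0) (e : E) {a b : ℝ}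
    (ha : 0 ≤ a) (hb : 0 ≤ b) : IntervalIntegrable (f.edgeOut e) volume a b := by
  classical
  have h1 : IntervalIntegrable (fun θ => ∑ r ∈ positions W' with edgeAt r = e, f.outflow r θ)
      volume a b := by
    have := IntervalIntegrable.sum (μ := volume) (a := a) (b := b)
      {r ∈ positions W' | edgeAt r = e} (f := fun r => (f.outflow r : ℝ → ℝ))
      fun r _ => (f.outflow r).intervalIntegrable ha hb
    refine this.congr fun x _ => ?_
    simp
  refine h1.congr_ae ?_
  exact ae_restrict_of_ae_restrict_of_subset (fun x hx => (le_min ha hb).trans hx.1.le)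
    (tsum_ae_eq_sum hf e).symm

end

namespace IsAssociated

variable {h : N.WalkFamily}

lemma le_exitTime (hf : IsAssociated h f) (e : E) {θ : ℝ} (hθ : 0 ≤ θ) :
    θ + N.τ e ≤ f.exitTime e θ := by
  have h1 : 0 ≤ f.queue e θ / N.ν e :=
    div_nonneg (sub_nonneg.2 (hf.weakConservation e θ hθ)) (N.ν_pos e).le
  unfold exitTime
  linarith

lemma exitTime_nonneg (hf : IsAssociated h f) (e : E) {θ : ℝ} (hθ : 0 ≤ θ) :
    0 ≤ f.exitTime e θ :=
  (add_nonneg hθ (N.τ_pos e).le).trans (hf.le_exitTime e hθ)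

lemma inflowCurve_source (hf : IsAssociated h f) (h0 : ∀ w, 0 ≤ h w) {r : N.Pos}
    (hr : predPos r = none) : f.inflowCurve r = networkInflow h r := by
  obtain ⟨w, ⟨_ | j, hj⟩⟩ := r
  · funext θ
    rcases le_total θ 0 with hθ | hθ
    · rw [(f.isCurve_inflowCurve _).zero θ hθ, networkInflow,
        (isCurve_cumulative (h0 _)).zero θ hθ]
    · rw [inflowCurve_of_nonneg hθ]
      exact primitive_congr (hf.source w hj) hθ
  · exact absurd hr (by simp [predPos])

lemma inflowCurve_node (hf : IsAssociated h f) {r r' : N.Pos}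
    (hr : predPos r = some r') : f.inflowCurve r = f.outflowCurve r' := by
  obtain ⟨w, ⟨_ | j, hj⟩⟩ := r
  · exact absurd hr (by simp [predPos])
  · simp only [predPos, Option.some.injEq] at hr
    subst hr
    funext θ
    exact (primitive_congr (hf.node w j hj) (le_max_right _ _)).symm

lemma outflowCurve_exitTime (hf : IsAssociated h f) (r : N.Pos) {θ : ℝ} (hθ : 0 ≤ θ) :
    f.outflowCurve r (f.exitTime (edgeAt r) θ) = f.inflowCurve r θ := by
  rw [outflowCurve_of_nonneg (hf.exitTime_nonneg _ hθ), inflowCurve_of_nonneg hθ]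
  exact hf.linkTransfer r θ hθ

/-- For `θ ≥ 0` the exit time exceeds `θ`, so by monotonicity the outflow by `θ` is at most the
inflow by `θ`. -/
lemma outflowCurve_eq_zero (hf : IsAssociated h f) {r : N.Pos} (hr : f.inflowCurve r = 0) :
    f.outflowCurve r = 0 := by
  funext θ
  refine le_antisymm ?_ ((f.isCurve_outflowCurve r).nonneg θ)
  have h1 := hf.outflowCurve_exitTime r (le_max_right θ 0)
  rw [hr] at h1
  refine le_of_le_of_eq ?_ h1
  refine (f.isCurve_outflowCurve r).mono ?_
  have := hf.le_exitTime (edgeAt r) (le_max_right θ 0)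
  have := N.τ_pos (edgeAt r)
  have := le_max_left θ 0
  linarith

lemma inflowCurve_eq_zero (hf : IsAssociated h f) {w : N.CWalk} (hw : h w = 0) :
    ∀ (j : ℕ) (hj : j < w.edges.length), f.inflowCurve ⟨w, ⟨j, hj⟩⟩ = 0 := by
  intro j
  induction j with
  | zero =>
    intro hj
    funext θ
    show ∫ z in (0 : ℝ)..(max θ 0), f.inflow ⟨w, ⟨0, hj⟩⟩ z = 0
    rw [primitive_congr (hf.source w hj) (le_max_right _ _), hw]
    exact congrFun cumulative_zero _
  | succ j ih =>
    intro hj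
    rw [hf.inflowCurve_node (r' := ⟨w, ⟨j, Nat.lt_of_succ_lt hj⟩⟩) rfl]
    exact hf.outflowCurve_eq_zero (ih _)

section

variable {W' : Finset N.CWalk} {τ₀ : ℝ} {h₀ : 0 < τ₀} {hτ : ∀ e, τ₀ ≤ N.τ e}

lemma inflowCurve_zero (hf : IsAssociated h f) (hz : ∀ w ∉ W', h w = 0) (r : N.Pos)
    (hr : r ∉ positions W') : f.inflowCurve r = 0 :=
  hf.inflowCurve_eq_zero (hz r.1 fun h => hr (mem_positions.2 h)) _ _

lemma isFamily (hf : IsAssociated h f) (hz : ∀ w ∉ W', h w = 0) :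
    (delayNetwork W' h₀ hτ).IsFamily f.inflowCurve where
  curve := f.isCurve_inflowCurve
  zero := hf.inflowCurve_zero hz

variable [Finite E] [Finite I]

/-- The axioms of an associated flow hold only at non-negative times. Extended by zero, its curves
satisfy on the whole line the hypotheses of `eq_edgeExit`. -/
lemma exitTime_eq (hf : IsAssociated h f) (hz : ∀ w ∉ W', h w = 0) (e : E) {θ : ℝ}
    (hθ : 0 ≤ θ) :
    f.exitTime e θ = (delayNetwork W' h₀ hτ).exit f.inflowCurve e θ := by
  classical
  have hzi : ∀ r ∉ positions W', f.inflow r =ᵐ[volume.restrict (Ici (0 : ℝ))] 0 := fun r hr =>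
    ae_eq_zero_of_inflowCurve (hf.inflowCurve_zero hz r hr)
  have hzo : ∀ r ∉ positions W', f.outflow r =ᵐ[volume.restrict (Ici (0 : ℝ))] 0 := fun r hr =>
    ae_eq_zero_of_outflowCurve (hf.outflowCurve_eq_zero (hf.inflowCurve_zero hz r hr))
  set D := delayNetwork W' h₀ hτ with hD
  have hτe := N.τ_pos e
  have hin : ∀ {θ}, 0 ≤ θ → f.cumEdgeIn e θ = D.edgeCurve f.inflowCurve e θ := fun h =>
    cumEdgeIn_eq hzi e h
  have hout : ∀ {θ}, 0 ≤ θ → f.cumEdgeOut e θ = D.edgeCurve f.outflowCurve e θ := fun h =>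
    cumEdgeOut_eq hzo e h
  have hF : IsCurve (D.edgeCurve f.inflowCurve e) := (hf.isFamily hz).isCurve_edgeCurve e
  have hG : IsCurve (D.edgeCurve f.outflowCurve e) :=
    isCurve_sum fun r _ => f.isCurve_outflowCurve r
  have hcons : ∀ θ, 0 ≤ θ →
      D.edgeCurve f.outflowCurve e (θ + N.τ e) ≤ D.edgeCurve f.inflowCurve e θ := fun θ hθ => by
    rw [← hin hθ, ← hout (add_nonneg hθ hτe.le)]
    exact hf.weakConservation e θ hθ
  have hG0 : ∀ t ≤ N.τ e, D.edgeCurve f.outflowCurve e t = 0 := fun t ht => by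
    refine le_antisymm ((hG.mono ht).trans ?_) (hG.nonneg t)
    have := hcons 0 le_rfl
    rwa [zero_add, hF.zero 0 le_rfl] at this
  -- The capacity condition controls the outflow rate only from time `τ` on; before that the outflow
  -- is zero by weak conservation at time `0`.
  have hlip' : ∀ ⦃a b⦄, N.τ e ≤ a → a ≤ b → D.edgeCurve f.outflowCurve e b -
      D.edgeCurve f.outflowCurve e a ≤ N.ν e * (b - a) := fun a b ha hab => by
    have ha0 := hτe.le.trans ha
    have hb0 := ha0.trans hab
    rw [← hout ha0, ← hout hb0, cumEdgeOut, cumEdgeOut,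
      intervalIntegral.integral_interval_sub_left (edgeOut_intervalIntegrable hzo e le_rfl hb0)
        (edgeOut_intervalIntegrable hzo e le_rfl ha0)]
    have hcap : ∀ᵐ x, x ∈ Icc a b → f.edgeOut e x ≤ N.ν e := by
      have h1 := (ae_restrict_iff' measurableSet_Ici).1 (hf.capacity e)
      filter_upwards [(measurePreserving_sub_right volume (N.τ e)).quasiMeasurePreserving.ae h1]
        with x hx hxab
      have := hx (sub_nonneg.2 (ha.trans hxab.1))
      rwa [sub_add_cancel] at this
    refine (intervalIntegral.integral_mono_ae_restrict hab
      (edgeOut_intervalIntegrable hzo e ha0 hb0) (intervalIntegrable_const (c := N.ν e))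
      ((ae_restrict_iff' measurableSet_Icc).2 hcap)).trans_eq ?_
    rw [intervalIntegral.integral_const, smul_eq_mul, mul_comm]
  have hlip : ∀ ⦃a b⦄, a ≤ b → D.edgeCurve f.outflowCurve e b -
      D.edgeCurve f.outflowCurve e a ≤ N.ν e * (b - a) := fun a b hab => by
    rcases le_total a (N.τ e) with ha | ha
    · rcases le_total b (N.τ e) with hb | hb
      · rw [hG0 a ha, hG0 b hb, sub_zero]
        exact mul_nonneg (N.ν_pos e).le (sub_nonneg.2 hab)
      · have := hlip' le_rfl hb
        rw [hG0 _ le_rfl] at this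
        rw [hG0 a ha]
        exact this.trans (mul_le_mul_of_nonneg_left (by linarith) (N.ν_pos e).le)
    · exact hlip' ha hab
  set T : ℝ → ℝ := fun θ => θ + (N.τ e + (D.edgeCurve f.inflowCurve e θ -
    D.edgeCurve f.outflowCurve e (θ + N.τ e)) / N.ν e) with hT
  have hTe : ∀ θ, 0 ≤ θ → f.exitTime e θ = T θ := fun θ hθ => by
    rw [exitTime, queue, hin hθ, hout (add_nonneg hθ hτe.le)]
  have hneg : ∀ θ ≤ 0, D.edgeCurve f.outflowCurve e (θ + N.τ e) = 0 ∧
      D.edgeCurve f.inflowCurve e θ = 0 := fun θ hθ =>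
    ⟨hG0 _ (by linarith), hF.zero θ hθ⟩
  have hlink : ∀ θ, D.edgeCurve f.outflowCurve e (T θ) = D.edgeCurve f.inflowCurve e θ := by
    intro θ
    rcases le_total θ 0 with hθ | hθ
    · obtain ⟨h1, h2⟩ := hneg θ hθ
      have : T θ = θ + N.τ e := by simp [hT, h1, h2]
      rw [this, h1, h2]
    · rw [← hTe θ hθ]
      refine Finset.sum_congr rfl fun r hr => ?_
      obtain rfl : edgeAt r = e := (Finset.mem_filter.1 hr).2
      exact hf.outflowCurve_exitTime r hθ
  have := eq_edgeExit (N.ν_pos e) hF hG.cont hG0 hlip (fun θ => by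
    rcases le_total θ 0 with hθ | hθ
    · obtain ⟨h1, h2⟩ := hneg θ hθ
      rw [h1, h2]
    · exact hcons θ hθ) (T := T) (fun θ => rfl) hlink
  rw [hTe θ hθ, this]
  rfl

/-- The exit time is onto the line, so link transfer determines the outflow at every time; for entry
times below zero both sides vanish. -/
lemma outflowCurve_eq (hf : IsAssociated h f) (hz : ∀ w ∉ W', h w = 0) (r : N.Pos) :
    f.outflowCurve r = (delayNetwork W' h₀ hτ).out f.inflowCurve r := by
  have hfam := hf.isFamily (h₀ := h₀) (hτ := hτ) hz
  set D := delayNetwork W' h₀ hτ with hD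
  have hF := hfam.isCurve_edgeCurve (edgeAt r)
  have key : ∀ y, 0 ≤ y → f.outflowCurve r (D.exit f.inflowCurve (edgeAt r) y) =
      f.inflowCurve r y := fun y hy => by
    rw [← hf.exitTime_eq hz _ hy, hf.outflowCurve_exitTime r hy]
  funext t
  obtain ⟨y, rfl⟩ := edgeExit_surjective (τ := N.τ (edgeAt r)) (N.ν_pos (edgeAt r)) hF t
  refine Eq.trans ?_ (hfam.out_exit r y).symm
  rcases le_total y 0 with hy | hy
  · rw [(f.isCurve_inflowCurve r).zero y hy]
    refine le_antisymm ?_ ((f.isCurve_outflowCurve r).nonneg _)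
    refine ((f.isCurve_outflowCurve r).mono (edgeExit_mono (N.ν_pos _) hF hy)).trans_eq ?_
    exact (key 0 le_rfl).trans ((f.isCurve_inflowCurve r).zero 0 le_rfl)
  · exact key y hy

lemma step_eq (hf : IsAssociated h f) (h0 : ∀ w, 0 ≤ h w) (hz : ∀ w ∉ W', h w = 0) :
    (delayNetwork W' h₀ hτ).step (networkInflow h) f.inflowCurve = f.inflowCurve := by
  funext r
  rcases hp : predPos r with _ | r'
  · rw [DelayNetwork.step_of_none hp, hf.inflowCurve_source h0 hp]
  · rw [DelayNetwork.step_of_some hp, hf.inflowCurve_node hp, hf.outflowCurve_eq hz]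

/-- There is at most one associated flow over time. -/
lemma unique (hf : IsAssociated h f) {f' : N.FlowOverTime} (hf' : IsAssociated h f')
    (h0 : ∀ w, 0 ≤ h w) (hz : ∀ w ∉ W', h w = 0) : f = f' := by
  obtain ⟨τ₀, h₀, hτ⟩ := N.exists_le_transitTime
  have hin : f.inflowCurve = f'.inflowCurve :=
    DelayNetwork.eq_of_step_eq (hf.isFamily (h₀ := h₀) (hτ := hτ) hz) (hf'.isFamily hz)
      (hf.step_eq h0 hz) (hf'.step_eq h0 hz)
  have hout : f.outflowCurve = f'.outflowCurve := by
    funext r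
    rw [hf.outflowCurve_eq (h₀ := h₀) (hτ := hτ) hz, hf'.outflowCurve_eq (h₀ := h₀) (hτ := hτ) hz,
      hin]
  have key : ∀ {g g' : L2Half}, (∀ θ, 0 ≤ θ → ∫ z in (0 : ℝ)..θ, g z = ∫ z in (0 : ℝ)..θ, g' z) →
      g = g' := fun {g g'} h => Lp.ext (ae_eq_of_primitive_eq
    (fun b hb => g.intervalIntegrable le_rfl hb) (fun b hb => g'.intervalIntegrable le_rfl hb) h)
  ext1
  · funext r
    refine key fun θ hθ => ?_
    have := congrFun (congrFun hin r) θ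
    rwa [inflowCurve_of_nonneg hθ, inflowCurve_of_nonneg hθ] at this
  · funext r
    refine key fun θ hθ => ?_
    have := congrFun (congrFun hout r) θ
    rwa [outflowCurve_of_nonneg hθ, outflowCurve_of_nonneg hθ] at this

end

end IsAssociated

end FlowOverTime

end Network

/-! ### Existence and uniqueness of the associated flow -/

namespace Network

variable {V E I : Type*} {N : Network V E I}

namespace FlowOverTime

section

variable [Finite E] [Finite I] {W' : Finset N.CWalk} {τ₀ : ℝ} {h₀ : 0 < τ₀}
  {hτ : ∀ e, τ₀ ≤ N.τ e} {h : N.WalkFamily} {f : N.FlowOverTime}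

/-- Rates whose primitives solve the loading problem form an associated flow. -/
lemma isAssociated_of_step_eq
    (hF : (delayNetwork W' h₀ hτ).IsFamily f.inflowCurve)
    (hs : (delayNetwork W' h₀ hτ).step (networkInflow h) f.inflowCurve = f.inflowCurve)
    (hout : f.outflowCurve = (delayNetwork W' h₀ hτ).out f.inflowCurve) : IsAssociated h f := by
  classical
  have hzi : ∀ r ∉ positions W', f.inflow r =ᵐ[volume.restrict (Ici (0 : ℝ))] 0 := fun r hr =>
    ae_eq_zero_of_inflowCurve (hF.zero r hr)
  have hzo : ∀ r ∉ positions W', f.outflow r =ᵐ[volume.restrict (Ici (0 : ℝ))] 0 := fun r hr =>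
    ae_eq_zero_of_outflowCurve (by rw [hout]; exact hF.out_eq_zero hr)
  have hexit : ∀ e θ, 0 ≤ θ →
      f.exitTime e θ = (delayNetwork W' h₀ hτ).exit f.inflowCurve e θ := fun e θ hθ => by
    have h1 := edgeExit_eq_queue (τ := N.τ e) (N.ν_pos e) (hF.isCurve_edgeCurve e) θ
    rw [exitTime, queue, cumEdgeIn_eq (h₀ := h₀) (hτ := hτ) hzi e hθ,
      cumEdgeOut_eq (h₀ := h₀) (hτ := hτ) hzo e (add_nonneg hθ (N.τ_pos e).le), hout,
      DelayNetwork.sum_out]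
    exact h1.symm
  refine ⟨fun w hw => ?_, fun w j hj => ?_, fun e => ?_, fun e θ hθ => ?_, fun r θ hθ => ?_⟩
  · refine ae_eq_of_primitive_eq (fun b hb => (f.inflow _).intervalIntegrable le_rfl hb)
      (fun b _ => extendZero_intervalIntegrable _ _ _) fun θ hθ => ?_
    have h1 := congrFun (congrFun hs ⟨w, ⟨0, hw⟩⟩) θ
    rw [DelayNetwork.step_of_none rfl, inflowCurve_of_nonneg hθ] at h1
    exact h1.symm
  · refine ae_eq_of_primitive_eq (fun b hb => (f.outflow _).intervalIntegrable le_rfl hb)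
      (fun b hb => (f.inflow _).intervalIntegrable le_rfl hb) fun θ hθ => ?_
    have h1 := congrFun (congrFun hs ⟨w, ⟨j + 1, hj⟩⟩) θ
    rw [DelayNetwork.step_of_some rfl, inflowCurve_of_nonneg hθ, ← hout,
      outflowCurve_of_nonneg hθ] at h1
    exact h1
  · refine ae_add_right (p := fun x => f.edgeOut e x ≤ N.ν e) ?_ (N.τ_pos e).le
    refine ae_le_of_primitive_sub_le
      (fun b hb => edgeOut_intervalIntegrable hzo e le_rfl hb) fun a b ha hab => ?_
    have h1 := cumEdgeOut_eq (h₀ := h₀) (hτ := hτ) hzo e ha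
    have h2 := cumEdgeOut_eq (h₀ := h₀) (hτ := hτ) hzo e (ha.trans hab)
    rw [hout, DelayNetwork.sum_out] at h1 h2
    rw [cumEdgeOut] at h1 h2
    rw [h1, h2]
    exact edgeOutflow_sub_le (N.ν_pos e) (hF.isCurve_edgeCurve e) (fun _ _ _ => le_rfl) hab
  · rw [cumEdgeIn_eq (h₀ := h₀) (hτ := hτ) hzi e hθ,
      cumEdgeOut_eq (h₀ := h₀) (hτ := hτ) hzo e (add_nonneg hθ (N.τ_pos e).le), hout,
      DelayNetwork.sum_out]
    exact edgeOutflow_le (N.ν_pos e) (hF.isCurve_edgeCurve e) (hF.isCurve_edgeCurve e) θ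
  · have h1 : 0 ≤ f.exitTime (edgeAt r) θ := by
      rw [hexit _ _ hθ]
      exact (add_nonneg hθ (N.τ_pos _).le).trans
        (le_edgeExit (N.ν_pos _) (hF.isCurve_edgeCurve _) θ)
    rw [← outflowCurve_of_nonneg h1, ← inflowCurve_of_nonneg hθ, hout, hexit _ _ hθ]
    exact hF.out_exit r θ

end

/-- The loading of a walk-flow on finitely many walks exists and is unique. -/
theorem existsUnique_isAssociated [Finite E] [Finite I] {W' : Finset N.CWalk} {h : N.WalkFamily}
    (hh : h ∈ N.walkFlows) (hz : ∀ w ∉ W', h w = 0) : ∃! f, IsAssociated h f := by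
  obtain ⟨τ₀, h₀, hτ⟩ := N.exists_le_transitTime
  obtain ⟨B, hB, hu⟩ := N.exists_inflow_le
  have hle := extendZero_le hh hu
  obtain ⟨F, hF, hs⟩ := (isFamily_networkInflow (h₀ := h₀) (hτ := hτ) hh.1 hz).exists_step_eq
  have hC : ∀ r θ, F r θ ≤ B * N.horizon := hF.le_of_step_eq hs
    (mul_nonneg hB N.horizon_nonneg)
    fun r θ => cumulative_le N.horizon_nonneg hB (hh.1 r.1) (hle r.1) θ
  have hlipO := fun r a b => hF.out_sub_le r (a := a) (b := b)
  -- Inflow curves are Lipschitz: with the bound on the network inflow at the first edge of a walk,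
  -- and with the capacity of the preceding edge afterwards.
  have hin : ∀ r, ∃ g : L2Half, 0 ≤ g ∧ ∀ θ, 0 ≤ θ → ∫ z in (0 : ℝ)..θ, g z = F r θ := by
    intro r
    rcases hp : predPos r with _ | r'
    · refine (hF.curve r).exists_density hB (fun a b hab => ?_) (hC r)
      rw [← hs, DelayNetwork.step_of_none hp]
      exact cumulative_sub_le hB (hle r.1) hab
    · refine (hF.curve r).exists_density (N.ν_pos (edgeAt r')).le (fun a b hab => ?_) (hC r)
      rw [← hs, DelayNetwork.step_of_some hp]
      exact hlipO r' a b hab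
  have hout : ∀ r, ∃ g : L2Half, 0 ≤ g ∧ ∀ θ, 0 ≤ θ → ∫ z in (0 : ℝ)..θ, g z =
      (delayNetwork W' h₀ hτ).out F r θ := fun r =>
    (hF.isCurve_out r).exists_density (N.ν_pos (edgeAt r)).le (hlipO r) fun θ => hC r _
  choose x hx0 hx using hin
  choose y hy0 hy using hout
  have hxF : (⟨x, y, hx0, hy0⟩ : N.FlowOverTime).inflowCurve = F := by
    funext r θ
    refine (hx r _ (le_max_right θ 0)).trans ?_
    rcases le_total θ 0 with hθ | hθ
    · rw [max_eq_right hθ, (hF.curve r).zero θ hθ, (hF.curve r).zero 0 le_rfl]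
    · rw [max_eq_left hθ]
  have hyF : (⟨x, y, hx0, hy0⟩ : N.FlowOverTime).outflowCurve =
      (delayNetwork W' h₀ hτ).out F := by
    funext r θ
    refine (hy r _ (le_max_right θ 0)).trans ?_
    rcases le_total θ 0 with hθ | hθ
    · rw [max_eq_right hθ, (hF.isCurve_out r).zero θ hθ, (hF.isCurve_out r).zero 0 le_rfl]
    · rw [max_eq_left hθ]
  have hass : IsAssociated h ⟨x, y, hx0, hy0⟩ :=
    isAssociated_of_step_eq (h₀ := h₀) (hτ := hτ) (by rwa [hxF]) (by rwa [hxF])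
      (by rw [hxF, hyF])
  exact ⟨_, hass, fun f' hf' => hf'.unique hass hh.1 hz⟩

end FlowOverTime

/-! ### Continuity of exit and arrival times -/

section Continuity

variable [Finite E] [Finite I] {S : Set N.WalkFamily} {W' : Finset N.CWalk}

lemma existsUnique_of_mem_feasibleSet {h : W' → L2On N.horizon} (hh : h ∈ feasibleSet S W') :
    ∃! f : N.FlowOverTime, f.IsAssociated (embed W' h) :=
  FlowOverTime.existsUnique_isAssociated hh.2 fun _ hw => embed_of_notMem h hw

lemma isAssociated_loading {h : W' → L2On N.horizon} (hh : h ∈ feasibleSet S W') :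
    (loading (embed W' h)).IsAssociated (embed W' h) :=
  Classical.epsilon_spec (existsUnique_of_mem_feasibleSet hh).exists

/-- Weak convergence of walk-flows implies uniform convergence of the cumulative inflows. -/
lemma eventually_abs_networkInflow_sub_le {h : ℕ → W' → L2On N.horizon} {h' : W' → L2On N.horizon}
    (hh : ∀ k, h k ∈ feasibleSet S W') (hh' : h' ∈ feasibleSet S W') (hw : WeakTendsto h h')
    {δ : ℝ} (hδ : 0 < δ) :
    ∀ᶠ k in atTop, ∀ r θ,
      |networkInflow (embed W' h') r θ - networkInflow (embed W' (h k)) r θ| ≤ δ := by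
  classical
  obtain ⟨B, hB, hu⟩ := N.exists_inflow_le
  have key : ∀ w ∈ W', ∀ᶠ k in atTop, ∀ θ,
      |cumulative (embed W' h' w) θ - cumulative (embed W' (h k) w) θ| ≤ δ := by
    intro w hwW
    refine tendstoUniformly_of_pointwise N.horizon_nonneg hB
      (fun k => isCurve_cumulative ((hh k).2.1 w)) (isCurve_cumulative (hh'.2.1 w))
      (fun k θ hθ => cumulative_of_ge hθ) (fun θ hθ => cumulative_of_ge hθ)
      (fun k a b hab => cumulative_sub_le hB (extendZero_le (hh k).2 hu w) hab)
      (fun a b hab => cumulative_sub_le hB (extendZero_le hh'.2 hu w) hab) (fun θ hθ => ?_) hδ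
    obtain ⟨φ, hφ⟩ := exists_inner_eq_cumulative N.horizon θ hθ
    -- Testing with `φ` at the walk `w` and zero elsewhere isolates one cumulative inflow.
    have hsum : ∀ g : W' → L2On N.horizon,
        ∑ a, (inner ℝ (g a) ((Pi.single ⟨w, hwW⟩ φ : W' → L2On N.horizon) a) : ℝ) =
          cumulative (embed W' g w) θ := by
      intro g
      rw [Finset.sum_eq_single ⟨w, hwW⟩, Pi.single_eq_same, hφ, embed_of_mem g hwW]
      · intro b _ hb
        rw [Pi.single_eq_of_ne hb, inner_zero_right]
      · exact fun h => absurd (Finset.mem_univ _) h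
    have := hw (Pi.single ⟨w, hwW⟩ φ)
    simpa only [hsum] using this
  filter_upwards [(Filter.eventually_all_finset W').2 key] with k hk r θ
  by_cases hr : r.1 ∈ W'
  · exact hk r.1 hr θ
  · rw [networkInflow, networkInflow, embed_of_notMem _ hr, embed_of_notMem _ hr, sub_self,
      abs_zero]
    exact hδ.le

/-- The exit times of a feasible flow extend to a continuous function on the line. -/
lemma continuous_exitTime {h : W' → L2On N.horizon} (hh : h ∈ feasibleSet S W') (e : E) :
    Continuous fun θ => (loading (embed W' h)).exitTime e (max θ 0) := by
  obtain ⟨τ₀, h₀, hτ⟩ := N.exists_le_transitTime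
  have ha := isAssociated_loading hh
  have hz : ∀ w ∉ W', embed W' h w = 0 := fun w hw => embed_of_notMem h hw
  have hfam := ha.isFamily (h₀ := h₀) (hτ := hτ) hz
  refine ((hfam.continuous_exit e).comp
    (continuous_id.max (continuous_const (y := (0 : ℝ))))).congr fun θ => ?_
  exact (ha.exitTime_eq hz e (le_max_right θ 0)).symm

variable (S W') in
open Classical in
/-- Exit times as continuous functions. -/
def exitMap (e : E) (h : W' → L2On N.horizon) : C(ℝ, ℝ) :=
  if hh : h ∈ feasibleSet S W' then
    ⟨fun θ => (loading (embed W' h)).exitTime e (max θ 0), continuous_exitTime hh e⟩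
  else 0

lemma exitMap_apply {h : W' → L2On N.horizon} (hh : h ∈ feasibleSet S W') (e : E) (θ : ℝ) :
    exitMap S W' e h θ = (loading (embed W' h)).exitTime e (max θ 0) := by
  rw [exitMap, dif_pos hh]
  rfl

lemma seqWeakStrongContinuousOn_exitMap (e : E) :
    SeqWeakStrongContinuousOn (exitMap S W' e) (feasibleSet S W') := by
  intro h h' hh hh' hw
  obtain ⟨τ₀, h₀, hτ⟩ := N.exists_le_transitTime
  have hz : ∀ (g : W' → L2On N.horizon), ∀ w ∉ W', embed W' g w = 0 := fun g w hw =>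
    embed_of_notMem g hw
  have hunif := DelayNetwork.tendstoUniformlyOn_exit
    (fun k => (isAssociated_loading (hh k)).isFamily (h₀ := h₀) (hτ := hτ) (hz _))
    ((isAssociated_loading hh').isFamily (hz _))
    (fun k => (isAssociated_loading (hh k)).step_eq (hh k).2.1 (hz _))
    ((isAssociated_loading hh').step_eq hh'.2.1 (hz _))
    (fun δ hδ => eventually_abs_networkInflow_sub_le hh hh' hw hδ) e
  rw [ContinuousMap.tendsto_iff_forall_isCompact_tendstoUniformlyOn]
  intro K hK
  obtain ⟨M, hM⟩ := hK.bddAbove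
  have h1 := ((hunif (max M 0)).comp (fun θ : ℝ => max θ 0)).mono
    (fun θ hθ => max_le_max_right 0 (hM hθ) : K ⊆ _)
  refine (h1.congr (Eventually.of_forall fun k θ _ => ?_)).congr_right fun θ _ => ?_
  · rw [exitMap_apply (hh k)]
    exact ((isAssociated_loading (hh k)).exitTime_eq (hz _) e (le_max_right θ 0)).symm
  · rw [exitMap_apply hh']
    exact ((isAssociated_loading hh').exitTime_eq (hz _) e (le_max_right θ 0)).symm

variable (S W') in
/-- Arrival times as continuous functions. -/
def arrivalMap : List E → (W' → L2On N.horizon) → C(ℝ, ℝ)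
  | [], _ => ContinuousMap.id ℝ
  | e :: l, h => (arrivalMap l h).comp (exitMap S W' e h)

lemma arrivalMap_apply {h : W' → L2On N.horizon} (hh : h ∈ feasibleSet S W') (l : List E) :
    ∀ θ, 0 ≤ θ → arrivalMap S W' l h θ = (loading (embed W' h)).arrival l θ := by
  induction l with
  | nil => exact fun _ _ => rfl
  | cons e l ih =>
    intro θ hθ
    have h1 := exitMap_apply hh e θ
    rw [max_eq_left hθ] at h1
    show arrivalMap S W' l h (exitMap S W' e h θ) = _
    rw [h1, ih _ ((isAssociated_loading hh).exitTime_nonneg e hθ)]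
    rfl

/-- Both factors of the composition vary with the flow, so joint continuity of composition in the
compact-open topology is used. -/
lemma seqWeakStrongContinuousOn_arrivalMap (l : List E) :
    SeqWeakStrongContinuousOn (arrivalMap S W' l) (feasibleSet S W') := by
  intro h h' hh hh' hw
  induction l with
  | nil => exact tendsto_const_nhds
  | cons e l ih =>
    exact (ContinuousMap.continuous_comp'.tendsto (exitMap S W' e h', arrivalMap S W' l h')).comp
      ((seqWeakStrongContinuousOn_exitMap e h h' hh hh' hw).prodMk_nhds ih)

end Continuity

end Network

/-- Composition of a sequentially weak-strong continuous map with a continuous map. -/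
lemma SeqWeakStrongContinuousOn.comp {ι : Type*} [Fintype ι] {T : ℝ} {X Y : Type*}
    [TopologicalSpace X] [TopologicalSpace Y] {A : (ι → L2On T) → X} {C : Set (ι → L2On T)}
    (hA : SeqWeakStrongContinuousOn A C) {Φ : X → Y} (hΦ : Continuous Φ) :
    SeqWeakStrongContinuousOn (fun h => Φ (A h)) C := fun h h' hh hh' hw =>
  (hΦ.tendsto _).comp (hA h h' hh hh' hw)

/-- The restriction of continuous functions to `[0, T]`, as a map to `L²([0, T])`, is
continuous. -/
lemma exists_continuous_toL2On {T : ℝ} (hT : 0 ≤ T) :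
    ∃ Φ : C(ℝ, ℝ) → L2On T, Continuous Φ ∧
      ∀ g, Φ g =ᵐ[volume.restrict (Icc (0 : ℝ) T)] g := by
  have : IsFiniteMeasure (volume.restrict (Icc 0 T)) :=
    ⟨by rw [Measure.restrict_apply_univ]; exact measure_Icc_lt_top⟩
  let clamp : C(ℝ, Icc (0 : ℝ) T) := ⟨projIcc 0 T hT, continuous_projIcc⟩
  -- Clamping the argument to `[0, T]` makes the function bounded without changing it there, so that
  -- the continuous map from bounded functions to `L²` applies.
  let ψ : C(ℝ, ℝ) → BoundedContinuousFunction ℝ ℝ := fun g =>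
    (BoundedContinuousFunction.mkOfCompact (g.restrict (Icc 0 T))).compContinuous clamp
  have hψ : Continuous ψ :=
    (BoundedContinuousFunction.continuous_compContinuous clamp).comp
      ((ContinuousMap.isometryEquivBoundedOfCompact (Icc (0 : ℝ) T) ℝ).continuous.comp
        (ContinuousMap.continuous_restrict _))
  refine ⟨fun g => BoundedContinuousFunction.toLp 2 (volume.restrict (Icc 0 T)) ℝ (ψ g),
    (ContinuousLinearMap.continuous _).comp hψ, fun g => ?_⟩
  filter_upwards [BoundedContinuousFunction.coeFn_toLp (p := 2)
    (volume.restrict (Icc (0 : ℝ) T)) ℝ (ψ g), ae_restrict_mem measurableSet_Icc] with x hx hxT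
  rw [hx]
  show g (projIcc 0 T hT x) = g x
  rw [projIcc_of_mem hT hxT]

end VickreyFlow

end

theorem mainTheorem3 {V E I : Type*} [Finite V] [Finite E] [Finite I] (N : VickreyFlow.Network V E I)
    (c : I → ℝ → ℝ → ℝ) (hc : ∀ i, VickreyFlow.IsAggregationFunction (c i))
    (S : Set N.WalkFamily) (W' : Finset N.CWalk) :
    (∀ h ∈ VickreyFlow.Network.feasibleSet S W',
      ∃! f : N.FlowOverTime, VickreyFlow.Network.FlowOverTime.IsAssociated (VickreyFlow.Network.embed W' h) f) ∧
    (∀ (M : ℝ) (e : E), 0 ≤ M →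
      ∃ A : (W' → VickreyFlow.L2On N.horizon) → C(Set.Icc (0 : ℝ) M, ℝ),
        (∀ h ∈ VickreyFlow.Network.feasibleSet S W', ∀ θ : Set.Icc (0 : ℝ) M,
          A h θ = (VickreyFlow.Network.loading (VickreyFlow.Network.embed W' h)).exitTime e θ) ∧
        VickreyFlow.SeqWeakStrongContinuousOn A (VickreyFlow.Network.feasibleSet S W')) ∧
    (∀ w ∈ W',
      ∃ A : (W' → VickreyFlow.L2On N.horizon) → VickreyFlow.L2On N.horizon,
        (∀ h ∈ VickreyFlow.Network.feasibleSet S W',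
          A h =ᵐ[MeasureTheory.volume.restrict (Set.Icc (0 : ℝ) N.horizon)]
            fun θ => c w.com ((VickreyFlow.Network.loading (VickreyFlow.Network.embed W' h)).travelTime w θ) w.price) ∧
        VickreyFlow.SeqWeakStrongContinuousOn A (VickreyFlow.Network.feasibleSet S W')) := by
  refine ⟨fun h hh => VickreyFlow.Network.existsUnique_of_mem_feasibleSet hh,
    fun M e _ => ?_, fun w _ => ?_⟩
  · refine ⟨fun h => (VickreyFlow.Network.exitMap S W' e h).restrict (Set.Icc 0 M),
      fun h hh θ => ?_, (VickreyFlow.Network.seqWeakStrongContinuousOn_exitMap e).comp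
        (ContinuousMap.continuous_restrict _)⟩
    have h1 := VickreyFlow.Network.exitMap_apply hh e θ
    rwa [max_eq_left θ.2.1] at h1
  · obtain ⟨Φ, hΦ, hΦa⟩ := VickreyFlow.exists_continuous_toL2On N.horizon_nonneg
    have hcc : Continuous fun x : ℝ => c w.com x w.price :=
      (hc w.com).continuous.comp (continuous_id.prodMk continuous_const)
    -- The price is constant along the walk, so the cost is postcomposition of the travel time with
    -- a continuous function of one variable.
    have hΨ : Continuous fun g : C(ℝ, ℝ) =>
        (⟨_, hcc⟩ : C(ℝ, ℝ)).comp (g - ContinuousMap.id ℝ) :=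
      (ContinuousMap.continuous_postcomp _).comp (continuous_id.sub continuous_const)
    refine ⟨fun h => Φ ((⟨_, hcc⟩ : C(ℝ, ℝ)).comp
      (VickreyFlow.Network.arrivalMap S W' w.edges h - ContinuousMap.id ℝ)), fun h hh => ?_,
      (VickreyFlow.Network.seqWeakStrongContinuousOn_arrivalMap w.edges).comp (hΦ.comp hΨ)⟩
    filter_upwards [hΦa _, MeasureTheory.ae_restrict_mem measurableSet_Icc] with θ hθ hθT
    rw [hθ]
    have h1 := VickreyFlow.Network.arrivalMap_apply hh w.edges θ hθT.1
    show c w.com (VickreyFlow.Network.arrivalMap S W' w.edges h θ - θ) w.price = _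
    rw [h1]
    rfl
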